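/- Let $V$ be a finite-dimensional complex vector space. For a finite subgroup $G\subset GL(V)$ and $g\in G$ write $V^g\subset V$ for the fixed subspace of $g$, $C(g)\subset G$ for the centralizer of $g$, and $V^g/C(g)=\operatorname{Spec}\mathcal O(V^g)^{C(g)}$ for the geometric quotient, where $\mathcal O(V^g)$ is the ring of polynomial functions on $V^g$. The rank of a linear group is the codimension of its subspace of invariant vectors. A reflection is an invertible linear map whose fixed subspace has codimension one. (a) Let $G\subset GL(V)$ be a finite complex reflection group (a finite group generated by reflections) of rank at most $2$. Then for every $g\in G$ the geometric quotient $V^g/C(g)$ is smooth over $\mathbb C$. (b) Let $U$ be a finite-dimensional real vector space, and let $G\subset GL(U)$ be a finite real reflection group (a finite group generated by reflections) that is either of rank at most $3$ or of type $H_4$. Let $G$ act on $V=U\otimes_{\mathbb R}\mathbb C$ by extension of scalars. Then for every $g\in G$ the geometric quotient $V^g/C(g)$ is smooth over $\mathbb C$. -/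

import Mathlib

open scoped TensorProduct

namespace ReflQuot

noncomputable section

/-- A (pseudo-)reflection of a finite-dimensional vector space: an invertible linear map whose
fixed subspace has codimension one. Inside a finite group over a field of characteristic zero this
is the usual notion of complex (resp. real) reflection. -/
def IsReflection {K V : Type*} [Field K] [AddCommGroup V] [Module K V] (s : V ≃ₗ[K] V) : Prop :=
  Module.finrank K (V ⧸ (s : V →ₗ[K] V).fixedSubmodule) = 1

/-- A finite group of linear automorphisms generated by the reflections it contains. For `K = ℂ`
these are the complex reflection groups, for `K = ℝ` the finite real reflection groups. -/
def IsReflectionGroup {K V : Type*} [Field K] [AddCommGroup V] [Module K V]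
    (G : Subgroup (V ≃ₗ[K] V)) : Prop :=
  Finite G ∧ Subgroup.closure {s : V ≃ₗ[K] V | s ∈ G ∧ IsReflection s} = G

/-- The subspace `V^G` of vectors fixed by all of `G`. -/
def fixedBy {K V : Type*} [Field K] [AddCommGroup V] [Module K V]
    (G : Subgroup (V ≃ₗ[K] V)) : Submodule K V :=
  ⨅ g : G, ((g : V ≃ₗ[K] V) : V →ₗ[K] V).fixedSubmodule

/-- The rank of a linear group: the codimension of `V^G` (at most `dim V`, with equality
if and only if `V^G = 0`). -/
def rank {K V : Type*} [Field K] [AddCommGroup V] [Module K V]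
    (G : Subgroup (V ≃ₗ[K] V)) : ℕ :=
  Module.finrank K (V ⧸ fixedBy G)

/-- `G` is a real reflection group of type `H₄`: it is generated by the reflections
`x ↦ x - f i x • α i` attached to simple roots `α i` and coroots `f i` (`i : Fin 4`), with
`f i (α j) = - 2 cos (π / m i j)`, where `m` is the Coxeter matrix of type `H₄`. -/
def IsOfTypeH4 {U : Type*} [AddCommGroup U] [Module ℝ U] (G : Subgroup (U ≃ₗ[ℝ] U)) : Prop :=
  ∃ (α : Fin 4 → U) (f : Fin 4 → Module.Dual ℝ U),
    (∀ i j, f i (α j) = -2 * Real.cos (Real.pi / (CoxeterMatrix.H₄ i j : ℝ))) ∧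
    Subgroup.closure {s : U ≃ₗ[ℝ] U | ∃ i, ∀ x, s x = x - f i x • α i} = G

/-- Extension of scalars from `GL(U)` to `GL(ℂ ⊗ U)`. -/
def complexifyHom (U : Type*) [AddCommGroup U] [Module ℝ U] :
    (U ≃ₗ[ℝ] U) →* ((ℂ ⊗[ℝ] U) ≃ₗ[ℂ] (ℂ ⊗[ℝ] U)) where
  toFun e := LinearEquiv.baseChange ℝ ℂ U U e
  map_one' := by
    ext x
    simp
  map_mul' e f := by
    ext x
    exact LinearMap.congr_fun (LinearMap.baseChange_mul (A := ℂ) (e : Module.End ℝ U) f) x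

/-- A real linear group, viewed as a group of automorphisms of the complexified space. -/
def complexify {U : Type*} [AddCommGroup U] [Module ℝ U] (G : Subgroup (U ≃ₗ[ℝ] U)) :
    Subgroup ((ℂ ⊗[ℝ] U) ≃ₗ[ℂ] (ℂ ⊗[ℝ] U)) :=
  G.map (complexifyHom U)

/-- The ring `𝒪(W)` of regular (polynomial) functions on a complex vector space `W`: the algebra of
functions generated by the linear functionals. -/
def regularFunctions (W : Type*) [AddCommGroup W] [Module ℂ W] : Subalgebra ℂ (W → ℂ) :=
  Algebra.adjoin ℂ (Set.range fun φ : Module.Dual ℂ W => (φ : W → ℂ))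

/-- The ring `𝒪(W)^Γ` of regular functions that are invariant under a linear action of `Γ`. -/
def invariantFunctions {Γ W : Type*} [Group Γ] [AddCommGroup W] [Module ℂ W]
    (ρ : Representation ℂ Γ W) : Subalgebra ℂ (W → ℂ) where
  carrier := {f | f ∈ regularFunctions W ∧ ∀ γ w, f (ρ γ w) = f w}
  mul_mem' := fun ⟨ha, ha'⟩ ⟨hb, hb'⟩ => ⟨mul_mem ha hb, fun γ w => by simp [ha', hb']⟩
  add_mem' := fun ⟨ha, ha'⟩ ⟨hb, hb'⟩ => ⟨add_mem ha hb, fun γ w => by simp [ha', hb']⟩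
  algebraMap_mem' := fun r => ⟨Subalgebra.algebraMap_mem _ r, fun _ _ => rfl⟩

/-- The geometric quotient `W / Γ` of the affine space `W` by a linear action of a finite
group `Γ`, that is, `Spec 𝒪(W)^Γ`. -/
def geometricQuotient {Γ : Type*} {W : Type*} [Group Γ] [AddCommGroup W]
    [Module ℂ W] (ρ : Representation ℂ Γ W) : AlgebraicGeometry.Scheme :=
  AlgebraicGeometry.Spec (CommRingCat.of (invariantFunctions ρ))

/-- The structure morphism of `W / Γ` over `Spec ℂ` (the field `ℂ` is lifted to the universe
of `W`). -/
def geometricQuotientStructure.{u} {Γ : Type*} {W : Type u} [Group Γ] [AddCommGroup W]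
    [Module ℂ W] (ρ : Representation ℂ Γ W) :
    geometricQuotient ρ ⟶ AlgebraicGeometry.Spec (CommRingCat.of (ULift.{u} ℂ)) :=
  AlgebraicGeometry.Spec.map (CommRingCat.ofHom
    ((algebraMap ℂ (invariantFunctions ρ)).comp
      (ULift.ringEquiv : ULift.{u} ℂ ≃+* ℂ).toRingHom))

/-- The action of the centralizer `C(g)` of `g ∈ G` on the fixed subspace `V^g`. -/
def centralizerRep {V : Type*} [AddCommGroup V] [Module ℂ V] (G : Subgroup (V ≃ₗ[ℂ] V)) (g : G) :
    Representation ℂ (Subgroup.centralizer ({g} : Set G))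
      ((g : V ≃ₗ[ℂ] V) : V →ₗ[ℂ] V).fixedSubmodule where
  toFun h := (((h : G) : V ≃ₗ[ℂ] V) : V →ₗ[ℂ] V).restrict (fun v hv => by
    have hc : (h : G) * g = g * (h : G) := (Subgroup.mem_centralizer_singleton_iff.1 h.2)
    have h1 := congrArg (fun k : G => (k : V ≃ₗ[ℂ] V) v) hc
    simp only [LinearMap.mem_fixedSubmodule_iff, LinearEquiv.coe_coe] at hv ⊢
    simp only [Subgroup.coe_mul, LinearEquiv.mul_apply, hv] at h1
    exact h1.symm)
  map_one' := by ext; rfl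
  map_mul' _ _ := by ext; rfl

/-- The geometric quotient `V^g / C(g)` is smooth over `ℂ`. -/
def SmoothFixedQuotient {V : Type*} [AddCommGroup V] [Module ℂ V] (G : Subgroup (V ≃ₗ[ℂ] V))
    (g : G) : Prop :=
  AlgebraicGeometry.Smooth (geometricQuotientStructure (centralizerRep G g))

end

end ReflQuot

/-! The quotient of a vector space by a finite group is smooth as soon as the group acts through a
group generated by reflections: the invariants are then a polynomial ring (Chevalley–Shephard–Todd,
`exists_algebraicIndependent_adjoin_eq`). So it suffices that `C(g)` acts on `V^g` through a group
generated by reflections, which is the condition `GeneratedOnFixed`.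

For `g = 1` this is the hypothesis on `G`. If `V^g` exceeds `V^G` by at most one dimension it is
automatic, since every element fixes `V^G` and hence a hyperplane of `V^g`. In rank at most two no
other case occurs.

For real groups the condition is checked over `ℝ` and passes to the complexification
(`generatedOnFixed_complexify`). Rank three adds the case of a reflection `g` with root `α`. An
element commuting with `g` sends `α` to `±α`; after composing with `g`, which is trivial on the
mirror, it fixes `α`. By Steinberg's theorem (`mem_closure_of_fixed`) it is then a product of
reflections in roots orthogonal to `α`, and these commute with `g`.

Type `H₄` adds the case where `V^g` has codimension two. Then `V^g` is the orthogonal complement of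
two roots, and in `H₄` any two roots have a common orthogonal root `γ` (`exists_orthogonal_root`, a
finite computation over `ℤ[φ]`). So `V^g` contains `γ`, and `C(g)` contains the reflection in `γ`.
Modulo `V^G` the space `V^g` is at most a plane, and a group of plane isometries that contains one
reflection is generated by reflections (`generatedOnFixed_of_root`). -/

namespace ReflQuot

open MvPolynomial

attribute [local instance] MvPolynomial.gradedAlgebra

/-! ### Graded and differential preliminaries on polynomials. -/

section Polynomials

variable {K σ : Type*} [Field K]

theorem homogeneousComponent_mul_of_isHomogeneous {f : MvPolynomial σ K} {d : ℕ}
    (hf : f.IsHomogeneous d) (c : MvPolynomial σ K) (n : ℕ) :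
    homogeneousComponent n (c * f) =
      if d ≤ n then homogeneousComponent (n - d) c * f else 0 := by
  have h := DirectSum.coe_decompose_mul_of_right_mem (homogeneousSubmodule σ K) (a := c) n hf
  have h1 : ∀ (p : MvPolynomial σ K) m,
      (DirectSum.decompose (homogeneousSubmodule σ K) p m : MvPolynomial σ K) =
        homogeneousComponent m p := decomposition.decompose'_apply
  rwa [h1, h1] at h

/-- If `f` is homogeneous and `a * f` lies in an ideal generated by homogeneous polynomials, where
`a` does not vanish at the origin, then `f` lies in that ideal. -/
theorem mem_span_of_mul_mem_span {s : Set (MvPolynomial σ K)}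
    (hs : ∀ p ∈ s, ∃ n, p.IsHomogeneous n) {a f : MvPolynomial σ K} {d : ℕ}
    (hf : f.IsHomogeneous d) (ha : constantCoeff a ≠ 0) (h : a * f ∈ Ideal.span s) :
    f ∈ Ideal.span s := by
  have hhom : (Ideal.span s).IsHomogeneous (homogeneousSubmodule σ K) :=
    Ideal.homogeneous_span _ _ fun p hp => hs p hp
  -- The ideal is homogeneous, and the degree-`d` component of `a * f` is the nonzero scalar `a(0)`
  -- times `f`.
  have h1 : homogeneousComponent d (a * f) ∈ Ideal.span s :=
    (mem_iff_homogeneousComponent_mem hhom _).1 h d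
  rw [homogeneousComponent_mul_of_isHomogeneous hf, if_pos le_rfl, Nat.sub_self,
    homogeneousComponent_zero] at h1
  have h2 := Ideal.mul_mem_left _ (C (constantCoeff a)⁻¹) h1
  rwa [← mul_assoc, ← C_mul, ← constantCoeff_eq, inv_mul_cancel₀ ha, C_1, one_mul] at h2

theorem totalDegree_pderiv_lt {p : MvPolynomial σ K} {i : σ} (h : pderiv i p ≠ 0) :
    (pderiv i p).totalDegree < p.totalDegree := by
  obtain ⟨m, hm, hdeg⟩ := Finset.exists_mem_eq_sup _ (support_nonempty.2 h)
    (fun m : σ →₀ ℕ => m.sum fun _ e => e)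
  have h0 : coeff (m + Finsupp.single i 1) p ≠ 0 := by
    rw [mem_support_iff, coeff_pderiv] at hm
    exact left_ne_zero_of_mul hm
  have h1 := le_totalDegree (mem_support_iff.2 h0)
  rw [totalDegree, hdeg]
  rw [Finsupp.sum_add_index' (by simp) (by simp)] at h1
  simp only [Finsupp.sum_single_index] at h1
  omega

theorem exists_pderiv_ne_zero [CharZero K] {p : MvPolynomial σ K} (h : ∀ c, p ≠ C c) :
    ∃ i, pderiv i p ≠ 0 := by
  classical
  obtain ⟨m, hm, hm0⟩ : ∃ m, coeff m p ≠ 0 ∧ m ≠ 0 := by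
    by_contra! H
    refine h (coeff 0 p) (MvPolynomial.ext _ _ fun m => ?_)
    rw [coeff_C]
    split_ifs with h0
    · rw [h0]
    · by_contra h1
      exact h0 (H m h1).symm
  obtain ⟨i, hi⟩ := Finsupp.ne_iff.1 hm0
  refine ⟨i, fun h0 => ?_⟩
  have h1 := congrArg (coeff (m - Finsupp.single i 1)) h0
  have hle : Finsupp.single i 1 ≤ m := by
    rw [Finsupp.single_le_iff]
    exact Nat.one_le_iff_ne_zero.2 hi
  rw [coeff_pderiv, tsub_add_cancel_of_le hle, coeff_zero] at h1
  rcases mul_eq_zero.1 h1 with h1 | h1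
  · exact hm h1
  · exact Nat.cast_add_one_ne_zero _ h1

theorem pderiv_aeval {ι : Type*} [Fintype ι] (f : ι → MvPolynomial σ K) (h : MvPolynomial ι K)
    (k : σ) : pderiv k (aeval f h) = ∑ i, aeval f (pderiv i h) * pderiv k (f i) := by
  classical
  induction h using MvPolynomial.induction_on with
  | C c => simp [algebraMap_eq]
  | add p q hp hq => simp only [map_add, hp, hq, add_mul, Finset.sum_add_distrib]
  | mul_X p i hp =>
    simp only [map_mul, aeval_X, Derivation.leibniz, smul_eq_mul, hp, pderiv_X, map_add, add_mul,
      Finset.sum_add_distrib]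
    congr 1
    · rw [Finset.sum_eq_single i]
      · simp
      · intro b _ hb
        rw [Pi.single_eq_of_ne hb.symm, map_zero, mul_zero, zero_mul]
      · simp
    · rw [Finset.mul_sum]
      exact Finset.sum_congr rfl fun j _ => by ring

end Polynomials

/-! ### Invariants, the Reynolds operator and Chevalley's lemma. -/

section Chevalley

variable {K σ Γ : Type*} [Field K] [Group Γ]

/-- The subalgebra of polynomials that are invariant under an action of a group. -/
def invariantPolynomials (a : Γ →* (MvPolynomial σ K →ₐ[K] MvPolynomial σ K)) :
    Subalgebra K (MvPolynomial σ K) where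
  carrier := {p | ∀ g, a g p = p}
  mul_mem' hp hq g := by rw [map_mul, hp g, hq g]
  add_mem' hp hq g := by rw [map_add, hp g, hq g]
  algebraMap_mem' r g := AlgHom.commutes _ r

/-- An action on polynomials preserves degrees. -/
def PreservesDegree (a : Γ →* (MvPolynomial σ K →ₐ[K] MvPolynomial σ K)) : Prop :=
  ∀ g n (p : MvPolynomial σ K), p.IsHomogeneous n → (a g p).IsHomogeneous n

/-- All differences `p - a s p` are divisible by one polynomial, with quotients of lower degree. -/
def ActsByReflection (a : Γ →* (MvPolynomial σ K →ₐ[K] MvPolynomial σ K)) (s : Γ) : Prop :=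
  ∃ l : MvPolynomial σ K, l ≠ 0 ∧
    ∀ p, ∃ q, p - a s p = l * q ∧ (q = 0 ∨ q.totalDegree < p.totalDegree)

/-- The ideal generated by the homogeneous invariants of positive degree. -/
noncomputable def hilbertIdeal (a : Γ →* (MvPolynomial σ K →ₐ[K] MvPolynomial σ K)) :
    Ideal (MvPolynomial σ K) :=
  Ideal.span {p | p ∈ invariantPolynomials a ∧ ∃ n, 0 < n ∧ p.IsHomogeneous n}

variable {a : Γ →* (MvPolynomial σ K →ₐ[K] MvPolynomial σ K)}

theorem homogeneousComponent_action (ha : PreservesDegree a) (g : Γ) (n : ℕ)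
    (p : MvPolynomial σ K) :
    homogeneousComponent n (a g p) = a g (homogeneousComponent n p) := by
  conv_lhs => rw [← sum_homogeneousComponent p]
  rw [map_sum, map_sum]
  have h1 : ∀ i, homogeneousComponent n (a g (homogeneousComponent i p)) =
      if n = i then a g (homogeneousComponent i p) else 0 := fun i =>
    homogeneousComponent_of_mem (ha g i _ (homogeneousComponent_isHomogeneous i p))
  simp only [h1, Finset.sum_ite_eq, Finset.mem_range]
  split_ifs with h
  · rfl
  · rw [homogeneousComponent_eq_zero _ _ (by omega), map_zero]

theorem homogeneousComponent_mem_invariantPolynomials (ha : PreservesDegree a) (n : ℕ)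
    {p : MvPolynomial σ K} (hp : p ∈ invariantPolynomials a) :
    homogeneousComponent n p ∈ invariantPolynomials a := fun g => by
  rw [← homogeneousComponent_action ha, hp g]

theorem constantCoeff_action (ha : PreservesDegree a) (g : Γ) (p : MvPolynomial σ K) :
    constantCoeff (a g p) = constantCoeff p := by
  have h := homogeneousComponent_action ha g 0 p
  rw [homogeneousComponent_zero, homogeneousComponent_zero, ← algebraMap_eq, AlgHom.commutes,
    algebraMap_eq] at h
  exact C_injective σ K h

theorem mem_hilbertIdeal (ha : PreservesDegree a) {p : MvPolynomial σ K}
    (hp : p ∈ invariantPolynomials a) (h0 : constantCoeff p = 0) : p ∈ hilbertIdeal a := by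
  rw [← sum_homogeneousComponent p]
  refine Ideal.sum_mem _ fun n _ => ?_
  rcases Nat.eq_zero_or_pos n with rfl | hn
  · rw [homogeneousComponent_zero, ← constantCoeff_eq, h0, C_0]
    exact Ideal.zero_mem _
  · exact Ideal.subset_span ⟨homogeneousComponent_mem_invariantPolynomials ha n hp, n, hn,
      homogeneousComponent_isHomogeneous n p⟩

theorem action_mem_hilbertIdeal (g : Γ) {p : MvPolynomial σ K} (hp : p ∈ hilbertIdeal a) :
    a g p ∈ hilbertIdeal a := by
  have h : hilbertIdeal a ≤ (hilbertIdeal a).comap (a g) := by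
    refine Ideal.span_le.2 fun q hq => ?_
    show a g q ∈ hilbertIdeal a
    rw [hq.1 g]
    exact Ideal.subset_span hq
  exact h hp

variable [Fintype Γ]

/-- The average of a polynomial over the action of a finite group. -/
noncomputable def reynolds (a : Γ →* (MvPolynomial σ K →ₐ[K] MvPolynomial σ K)) :
    MvPolynomial σ K →ₗ[K] MvPolynomial σ K :=
  (Fintype.card Γ : K)⁻¹ • ∑ g, (a g).toLinearMap

theorem reynolds_apply (p : MvPolynomial σ K) :
    reynolds a p = (Fintype.card Γ : K)⁻¹ • ∑ g, a g p := by
  simp [reynolds]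

theorem reynolds_mem (p : MvPolynomial σ K) : reynolds a p ∈ invariantPolynomials a := fun g => by
  rw [reynolds_apply, map_smul, map_sum]
  congr 1
  refine Fintype.sum_equiv (Equiv.mulLeft g) _ _ fun h => ?_
  rw [Equiv.coe_mulLeft, map_mul]
  rfl

theorem reynolds_mul {u : MvPolynomial σ K} (hu : u ∈ invariantPolynomials a)
    (p : MvPolynomial σ K) : reynolds a (p * u) = reynolds a p * u := by
  rw [reynolds_apply, reynolds_apply, smul_mul_assoc, Finset.sum_mul]
  congr 1
  exact Finset.sum_congr rfl fun g _ => by rw [map_mul, hu g]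

variable [CharZero K]

theorem card_inv_smul_sum_const {M : Type*} [AddCommGroup M] [Module K M] (m : M) :
    (Fintype.card Γ : K)⁻¹ • ∑ _g : Γ, m = m := by
  rw [Finset.sum_const, Finset.card_univ, ← Nat.cast_smul_eq_nsmul K, smul_smul,
    inv_mul_cancel₀ (Nat.cast_ne_zero.2 Fintype.card_ne_zero), one_smul]

theorem reynolds_of_mem {u : MvPolynomial σ K} (hu : u ∈ invariantPolynomials a) :
    reynolds a u = u := by
  rw [reynolds_apply, Finset.sum_congr rfl fun g _ => hu g, card_inv_smul_sum_const]

theorem constantCoeff_reynolds (ha : PreservesDegree a) (p : MvPolynomial σ K) :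
    constantCoeff (reynolds a p) = constantCoeff p := by
  rw [reynolds_apply, constantCoeff_smul, map_sum,
    Finset.sum_congr rfl fun g _ => constantCoeff_action ha g p, card_inv_smul_sum_const]

/-- Chevalley's lemma: in a relation `∑ p i * u i = 0` between invariants `u i`, none of which is,
locally at the origin, a combination of the others, the coefficients lie in the Hilbert ideal. -/
theorem coeff_mem_hilbertIdeal (ha : PreservesDegree a)
    (hgen : ∀ g, ∃ k ∈ Subgroup.closure {s | ActsByReflection a s}, a g = a k)
    {ι : Type*} [DecidableEq ι] {M : Finset ι} {u : ι → MvPolynomial σ K}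
    (hu : ∀ i, u i ∈ invariantPolynomials a) {i : ι} (hi : i ∈ M)
    (hred : ∀ b ∈ invariantPolynomials a, constantCoeff b ≠ 0 → ∀ c : ι → MvPolynomial σ K,
      (∀ j, c j ∈ invariantPolynomials a) → b * u i ≠ ∑ j ∈ M.erase i, c j * u j)
    (p : ι → MvPolynomial σ K) (hp : ∑ j ∈ M, p j * u j = 0) : p i ∈ hilbertIdeal a := by
  induction hn : (p i).totalDegree using Nat.strong_induction_on generalizing p with
  | _ n IH =>
  -- Averaging the relation makes its coefficients invariant without changing their constant terms.
  -- A nonzero constant term at `i` would make `u i` redundant.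
  have h0 : constantCoeff (p i) = 0 := by
    by_contra h0
    refine hred (reynolds a (p i)) (reynolds_mem _) (by rwa [constantCoeff_reynolds ha])
      (fun j => reynolds a (-p j)) (fun j => reynolds_mem _) ?_
    simp only [← reynolds_mul (hu _), ← map_sum]
    congr 1
    rw [← Finset.add_sum_erase _ _ hi] at hp
    simpa using eq_neg_of_add_eq_zero_left hp
  have hs : ∀ s, ActsByReflection a s → p i - a s (p i) ∈ hilbertIdeal a := by
    rintro s ⟨l, hl, hq⟩
    choose q hq hdeg using hq
    -- Subtracting from the relation its image under `s` leaves a multiple of `l`. Cancelling `l`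
    -- gives a relation whose `i`-th coefficient is zero or of lower degree.
    have hrel : ∑ j ∈ M, q (p j) * u j = 0 := by
      have h1 : l * ∑ j ∈ M, q (p j) * u j = 0 := by
        calc l * ∑ j ∈ M, q (p j) * u j = ∑ j ∈ M, (p j - a s (p j)) * u j := by
              rw [Finset.mul_sum]
              exact Finset.sum_congr rfl fun j _ => by rw [hq, mul_assoc]
          _ = ∑ j ∈ M, p j * u j - a s (∑ j ∈ M, p j * u j) := by
              rw [map_sum, ← Finset.sum_sub_distrib]
              exact Finset.sum_congr rfl fun j _ => by rw [map_mul, hu j s, sub_mul]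
          _ = 0 := by rw [hp, map_zero, sub_zero]
      exact (mul_eq_zero.1 h1).resolve_left hl
    rw [hq]
    rcases hdeg (p i) with h | h
    · rw [h, mul_zero]
      exact Ideal.zero_mem _
    · exact Ideal.mul_mem_left _ _ (IH _ (hn ▸ h) _ hrel rfl)
  have hk : ∀ k ∈ Subgroup.closure {s | ActsByReflection a s},
      p i - a k (p i) ∈ hilbertIdeal a := by
    intro k hk
    induction hk using Subgroup.closure_induction with
    | mem s h => exact hs s h
    | one => simp
    | mul g h _ _ hg hh =>
      have h1 := add_mem hg (action_mem_hilbertIdeal g hh)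
      rwa [map_sub, ← AlgHom.mul_apply, ← map_mul, sub_add_sub_cancel] at h1
    | inv g _ hg =>
      have h1 := neg_mem (action_mem_hilbertIdeal g⁻¹ hg)
      rwa [map_sub, ← AlgHom.mul_apply, ← map_mul, inv_mul_cancel, map_one, AlgHom.one_apply,
        neg_sub] at h1
  -- Modulo the Hilbert ideal `p i` is fixed by the group, hence equals its average, an invariant
  -- without constant term.
  have hg : p i - reynolds a (p i) ∈ hilbertIdeal a := by
    have h1 : p i - reynolds a (p i) =
        (Fintype.card Γ : K)⁻¹ • ∑ g, (p i - a g (p i)) := by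
      rw [Finset.sum_sub_distrib, smul_sub, card_inv_smul_sum_const, reynolds_apply]
    rw [h1, smul_eq_C_mul]
    refine Ideal.mul_mem_left _ _ (Ideal.sum_mem _ fun g _ => ?_)
    obtain ⟨k, hk', h⟩ := hgen g
    rw [h]
    exact hk k hk'
  have h2 := add_mem hg (mem_hilbertIdeal ha (reynolds_mem (p i))
    (by rw [constantCoeff_reynolds ha, h0]))
  rwa [sub_add_cancel] at h2

end Chevalley

end ReflQuot

namespace ReflQuot

open MvPolynomial

/-! ### The Chevalley–Shephard–Todd theorem. -/

section Generators

variable {K σ Γ : Type*} [Field K] [Group Γ]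
  {a : Γ →* (MvPolynomial σ K →ₐ[K] MvPolynomial σ K)}

/-- An irredundant finite system of homogeneous invariants generating the Hilbert ideal. -/
theorem exists_irredundant_generators [Finite σ]
    (a : Γ →* (MvPolynomial σ K →ₐ[K] MvPolynomial σ K)) :
    ∃ F : Finset (MvPolynomial σ K),
      (∀ p ∈ F, p ∈ invariantPolynomials a ∧ ∃ n, 0 < n ∧ p.IsHomogeneous n) ∧
      Ideal.span (F : Set (MvPolynomial σ K)) = hilbertIdeal a ∧
      ∀ p ∈ F, p ∉ Ideal.span ((F : Set (MvPolynomial σ K)) \ {p}) := by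
  classical
  let Q : Finset (MvPolynomial σ K) → Prop := fun F =>
    (∀ p ∈ F, p ∈ invariantPolynomials a ∧ ∃ n, 0 < n ∧ p.IsHomogeneous n) ∧
      Ideal.span (F : Set (MvPolynomial σ K)) = hilbertIdeal a
  have hex : ∃ F, Q F := by
    obtain ⟨F, hF, h⟩ := (Submodule.fg_span_iff_fg_span_finset_subset _).1
      (IsNoetherian.noetherian (hilbertIdeal a))
    exact ⟨F, fun p hp => hF hp, h.symm⟩
  obtain ⟨F, hF, hmin⟩ := exists_minimal_of_wellFoundedLT Q hex
  refine ⟨F, hF.1, hF.2, fun p hp hmem => ?_⟩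
  have h1 : Q (F.erase p) := by
    refine ⟨fun q hq => hF.1 q (Finset.mem_of_mem_erase hq), ?_⟩
    rw [Finset.coe_erase, ← hF.2]
    refine le_antisymm (Ideal.span_mono Set.sdiff_subset) (Ideal.span_le.2 fun q hq => ?_)
    by_cases hqp : q = p
    · rwa [hqp]
    · exact Ideal.subset_span ⟨hq, hqp⟩
  exact Finset.notMem_erase p F (hmin h1 (Finset.erase_subset _ _) hp)

/-- A finite family of invariants is generated, locally at the origin, by a subfamily none of whose
members is a combination of the others. -/
theorem exists_locally_minimal_subfamily {ι : Type*} [Fintype ι] [DecidableEq ι]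
    (h : ι → MvPolynomial σ K) :
    ∃ (M : Finset ι) (b : MvPolynomial σ K) (c : ι → ι → MvPolynomial σ K),
      (∀ j, b * h j = ∑ i ∈ M, c j i * h i) ∧ constantCoeff b ≠ 0 ∧
      (∀ i ∈ M, constantCoeff (c i i) ≠ 0) ∧
      ∀ i ∈ M, ∀ b ∈ invariantPolynomials a, constantCoeff b ≠ 0 → ∀ c : ι → MvPolynomial σ K,
        (∀ j, c j ∈ invariantPolynomials a) → b * h i ≠ ∑ j ∈ M.erase i, c j * h j := by
  let Q : Finset ι → Prop := fun M => ∃ b ∈ invariantPolynomials a, constantCoeff b ≠ 0 ∧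
    ∃ c : ι → ι → MvPolynomial σ K, (∀ j i, c j i ∈ invariantPolynomials a) ∧
      ∀ j, b * h j = ∑ i ∈ M, c j i * h i
  have hQ : Q Finset.univ := by
    refine ⟨1, one_mem _, by simp, fun j i => if i = j then 1 else 0, fun j i => ?_, fun j => ?_⟩
    · dsimp only
      split_ifs
      exacts [one_mem _, zero_mem _]
    · simp
  obtain ⟨M, hM, hmin⟩ := exists_minimal_of_wellFoundedLT Q ⟨_, hQ⟩
  obtain ⟨b, hb, hb0, c, hc, hbc⟩ := hM
  -- For `j ∈ M` the given expansion is replaced by the tautology `b * h j = b * h j`, so that the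
  -- diagonal coefficients do not vanish at the origin.
  refine ⟨M, b, fun j i => if j ∈ M then (if i = j then b else 0) else c j i, fun j => ?_, hb0,
    fun i hi => by simpa [hi] using hb0, fun i hi b' hb' hb0' c' hc' heq => ?_⟩
  · by_cases hj : j ∈ M
    · simp [hj]
    · simp only [hj, if_false, hbc]
  · have h1 : Q (M.erase i) := by
      refine ⟨b' * b, mul_mem hb' hb, by simp [hb0, hb0'],
        fun j k => b' * c j k + c j i * c' k, fun j k => add_mem (mul_mem hb' (hc _ _))
          (mul_mem (hc _ _) (hc' _)), fun j => ?_⟩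
      simp only [add_mul, Finset.sum_add_distrib, mul_assoc, ← Finset.mul_sum, ← heq]
      rw [hbc, ← Finset.add_sum_erase _ _ hi]
      ring
    exact Finset.notMem_erase i M (hmin h1 (Finset.erase_subset _ _) hi)

variable [Fintype Γ] [CharZero K]

/-- Homogeneous invariants generating the Hilbert ideal generate the algebra of invariants. -/
theorem adjoin_eq_invariantPolynomials (ha : PreservesDegree a) {F : Finset (MvPolynomial σ K)}
    (hF : ∀ p ∈ F, p ∈ invariantPolynomials a ∧ ∃ n, 0 < n ∧ p.IsHomogeneous n)
    (hspan : Ideal.span (F : Set (MvPolynomial σ K)) = hilbertIdeal a) :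
    Algebra.adjoin K (F : Set (MvPolynomial σ K)) = invariantPolynomials a := by
  refine le_antisymm (Algebra.adjoin_le fun p hp => (hF p hp).1) ?_
  have key : ∀ n, ∀ p ∈ invariantPolynomials a, p.IsHomogeneous n →
      p ∈ Algebra.adjoin K (F : Set (MvPolynomial σ K)) := by
    intro n
    induction n using Nat.strong_induction_on with
    | _ n IH =>
    intro p hp hn
    have hpn := homogeneousComponent_eq_self hn
    rcases Nat.eq_zero_or_pos n with rfl | hpos
    · rw [← hpn, homogeneousComponent_zero]
      exact Subalgebra.algebraMap_mem _ _
    · have hpI : p ∈ Ideal.span (F : Set (MvPolynomial σ K)) := by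
        rw [hspan]
        exact Ideal.subset_span ⟨hp, n, hpos, hn⟩
      obtain ⟨c, -, hc⟩ := Submodule.mem_span_finset.1 hpI
      -- Taking the degree-`n` part and averaging turns the coefficients into invariants of degree
      -- less than `n`, to which induction applies.
      have h1 : p = ∑ f ∈ F, reynolds a (homogeneousComponent n (c f * f)) := by
        rw [← map_sum, ← map_sum]
        simp only [smul_eq_mul] at hc
        rw [hc, hpn, reynolds_of_mem hp]
      rw [h1]
      refine Subalgebra.sum_mem _ fun f hf => ?_
      obtain ⟨hfi, d, hd, hfd⟩ := hF f hf
      rw [homogeneousComponent_mul_of_isHomogeneous hfd]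
      split_ifs with hle
      · rw [reynolds_mul hfi]
        refine Subalgebra.mul_mem _ (IH (n - d) (by omega) _ (reynolds_mem _) ?_)
          (Algebra.subset_adjoin hf)
        rw [reynolds_apply, smul_eq_C_mul]
        exact (IsHomogeneous.sum _ _ _ fun g _ =>
          ha g _ _ (homogeneousComponent_isHomogeneous _ _)).C_mul _
      · rw [map_zero]
        exact Subalgebra.zero_mem _
  intro p hp
  rw [← sum_homogeneousComponent p]
  exact Subalgebra.sum_mem _ fun n _ => key n _
    (homogeneousComponent_mem_invariantPolynomials ha n hp) (homogeneousComponent_isHomogeneous n p)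

/-- An irredundant homogeneous system of generators of the Hilbert ideal of a group generated by
reflections is algebraically independent. -/
theorem algebraicIndependent_of_irredundant [Finite σ] (ha : PreservesDegree a)
    (hgen : ∀ g, ∃ k ∈ Subgroup.closure {s | ActsByReflection a s}, a g = a k)
    {F : Finset (MvPolynomial σ K)}
    (hF : ∀ p ∈ F, p ∈ invariantPolynomials a ∧ ∃ n, 0 < n ∧ p.IsHomogeneous n)
    (hspan : Ideal.span (F : Set (MvPolynomial σ K)) = hilbertIdeal a)
    (hirr : ∀ p ∈ F, p ∉ Ideal.span ((F : Set (MvPolynomial σ K)) \ {p})) :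
    AlgebraicIndependent K ((↑) : F → MvPolynomial σ K) := by
  classical
  cases nonempty_fintype σ
  set f : F → MvPolynomial σ K := (↑) with hf
  choose hinv d hd hdeg using fun i : F => hF i i.2
  rw [algebraicIndependent_iff]
  by_contra! hex
  -- In a relation of least degree a nonzero partial derivative is no longer a relation. The
  -- relation need not be weighted homogeneous, so the `u i` below need not be homogeneous; this is
  -- why minimal subfamilies are taken locally at the origin.
  obtain ⟨h, hh0, hmin⟩ := exists_minimalFor_of_wellFoundedLT
    (fun p : MvPolynomial F K => aeval f p = 0 ∧ p ≠ 0) totalDegree hex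
  have hnc : ∀ c, h ≠ C c := by
    rintro c rfl
    apply hh0.2
    have := hh0.1
    rw [aeval_C, algebraMap_eq, C_eq_zero] at this
    rw [this, C_0]
  obtain ⟨i₁, hi₁⟩ := exists_pderiv_ne_zero hnc
  let u : F → MvPolynomial σ K := fun i => aeval f (pderiv i h)
  have hu1 : u i₁ ≠ 0 := fun h0 =>
    absurd (hmin ⟨h0, hi₁⟩ (totalDegree_pderiv_lt hi₁).le) (totalDegree_pderiv_lt hi₁).not_ge
  have hu : ∀ i, u i ∈ invariantPolynomials a := fun i g => by
    have h1 : (a g).comp (aeval f) = aeval f := algHom_ext fun j => by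
      rw [AlgHom.comp_apply, aeval_X, hinv j g]
    exact DFunLike.congr_fun h1 _
  obtain ⟨M, b, c, hbc, hb0, hc0, hred⟩ := exists_locally_minimal_subfamily (a := a) u
  obtain ⟨i, hi⟩ : M.Nonempty := by
    by_contra hM
    rw [Finset.not_nonempty_iff_eq_empty] at hM
    have h1 := hbc i₁
    rw [hM, Finset.sum_empty] at h1
    rcases mul_eq_zero.1 h1 with h1 | h1
    · exact hb0 (by rw [h1, map_zero])
    · exact hu1 h1
  -- Differentiating `h(f) = 0` by the chain rule gives a relation among all the `u j`. After
  -- multiplication by `b` it involves only those in `M`, and Chevalley's lemma applies.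
  have hrel : ∀ k, ∑ j, c j i * pderiv k (f j) ∈ hilbertIdeal a := by
    intro k
    refine coeff_mem_hilbertIdeal ha hgen hu hi (hred i hi)
      (fun i => ∑ j, c j i * pderiv k (f j)) ?_
    have h1 := pderiv_aeval f h k
    rw [hh0.1, map_zero] at h1
    calc ∑ m ∈ M, (∑ j, c j m * pderiv k (f j)) * u m
        = ∑ j, (∑ m ∈ M, c j m * u m) * pderiv k (f j) := by
          simp only [Finset.sum_mul]
          rw [Finset.sum_comm]
          exact Finset.sum_congr rfl fun j _ => Finset.sum_congr rfl fun m _ => by ring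
      _ = b * ∑ j, u j * pderiv k (f j) := by
          rw [Finset.mul_sum]
          exact Finset.sum_congr rfl fun j _ => by rw [← hbc, mul_assoc]
      _ = 0 := by rw [← h1, mul_zero]
  have hq : ∀ k, ∃ q : F → MvPolynomial σ K,
      ∑ j, c j i * pderiv k (f j) = ∑ j, q j * f j := by
    intro k
    have h1 := hrel k
    rw [← hspan] at h1
    obtain ⟨q, hq⟩ := Submodule.mem_span_finset'.1 h1
    exact ⟨q, hq.symm⟩
  choose q hq using hq
  -- Multiplying by `X k` and summing over `k` recovers the `f j` by Euler's formula, while the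
  -- right-hand coefficients acquire zero constant term.
  have heuler : ∑ j, c j i * (d j • f j) = ∑ j, (∑ k, X k * q k j) * f j := by
    calc ∑ j, c j i * (d j • f j) = ∑ j, c j i * ∑ k, X k * pderiv k (f j) :=
          Finset.sum_congr rfl fun j _ => by rw [(hdeg j).sum_X_mul_pderiv]
      _ = ∑ k, X k * ∑ j, c j i * pderiv k (f j) := by
          simp only [Finset.mul_sum]
          rw [Finset.sum_comm]
          exact Finset.sum_congr rfl fun j _ => Finset.sum_congr rfl fun m _ => by ring
      _ = ∑ j, (∑ k, X k * q k j) * f j := by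
          simp only [hq, Finset.mul_sum, Finset.sum_mul]
          rw [Finset.sum_comm]
          exact Finset.sum_congr rfl fun j _ => Finset.sum_congr rfl fun m _ => by ring
  let w : F → MvPolynomial σ K := fun j => (d j : MvPolynomial σ K) * c j i - ∑ k, X k * q k j
  have hw : ∑ j, w j * f j = 0 := by
    simp only [w, sub_mul, Finset.sum_sub_distrib]
    rw [← heuler, sub_eq_zero]
    exact Finset.sum_congr rfl fun j _ => by rw [nsmul_eq_mul]; ring
  -- Only `d i * c i i` contributes at the origin, and `d i ≠ 0` in characteristic zero. Hence `f i`
  -- lies in the ideal of the other generators, against irredundancy.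
  have hwi : constantCoeff (w i) ≠ 0 := by
    have h2 : constantCoeff (w i) = d i * constantCoeff (c i i) := by
      simp [w, map_sub, map_mul, map_sum, map_natCast]
    rw [h2]
    exact mul_ne_zero (Nat.cast_ne_zero.2 (hd i).ne') (hc0 i hi)
  refine hirr i i.2 (mem_span_of_mul_mem_span (fun p hp => ?_) (hdeg i) hwi ?_)
  · exact ⟨_, hdeg ⟨p, hp.1⟩⟩
  · rw [← Finset.add_sum_erase _ _ (Finset.mem_univ i)] at hw
    rw [show w i * (i : MvPolynomial σ K) = _ from eq_neg_of_add_eq_zero_left hw]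
    refine neg_mem (Ideal.sum_mem _ fun j hj => Ideal.mul_mem_left _ _ (Ideal.subset_span ?_))
    exact ⟨j.2, fun h => Finset.ne_of_mem_erase hj (Subtype.ext h)⟩

/-- The Chevalley–Shephard–Todd theorem: the invariants of a finite group generated by reflections
form a polynomial algebra. -/
theorem exists_algebraicIndependent_adjoin_eq [Finite σ] (ha : PreservesDegree a)
    (hgen : ∀ g, ∃ k ∈ Subgroup.closure {s | ActsByReflection a s}, a g = a k) :
    ∃ F : Finset (MvPolynomial σ K), AlgebraicIndependent K ((↑) : F → MvPolynomial σ K) ∧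
      Algebra.adjoin K (F : Set (MvPolynomial σ K)) = invariantPolynomials a := by
  obtain ⟨F, hF, hspan, hirr⟩ := exists_irredundant_generators a
  exact ⟨F, algebraicIndependent_of_irredundant ha hgen hF hspan hirr,
    adjoin_eq_invariantPolynomials ha hF hspan⟩

end Generators

end ReflQuot

namespace ReflQuot

open MvPolynomial

/-! ### From linear representations to polynomial actions, and smoothness of the quotient. -/

section Coordinates

variable {W ι : Type*} [AddCommGroup W] [Module ℂ W]

/-- Polynomials in the coordinates of a basis, viewed as functions. -/
noncomputable def toFunction (b : Module.Basis ι ℂ W) : MvPolynomial ι ℂ →ₐ[ℂ] (W → ℂ) :=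
  aeval fun i w => b.coord i w

theorem toFunction_apply (b : Module.Basis ι ℂ W) (p : MvPolynomial ι ℂ) (w : W) :
    toFunction b p w = eval (fun i => b.coord i w) p := by
  have h : (Pi.evalAlgHom ℂ (fun _ : W => ℂ) w).comp (toFunction b) =
      aeval fun i => b.coord i w := by
    refine algHom_ext fun i => ?_
    simp [toFunction]
  exact (DFunLike.congr_fun h p).trans (by rw [← coe_aeval_eq_eval]; rfl)

variable [Finite ι]

theorem toFunction_injective (b : Module.Basis ι ℂ W) : Function.Injective (toFunction b) := by
  intro p q h
  refine MvPolynomial.funext fun x => ?_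
  have h1 := congrFun h (b.equivFun.symm x)
  have h2 : (fun i => b.coord i (b.equivFun.symm x)) = x := by
    funext i
    rw [Module.Basis.coord_apply, ← Module.Basis.equivFun_apply, LinearEquiv.apply_symm_apply]
  rwa [toFunction_apply, toFunction_apply, h2] at h1

/-- The linear polynomial attached to a linear functional. -/
noncomputable def linearPolynomial (b : Module.Basis ι ℂ W) (φ : Module.Dual ℂ W) :
    MvPolynomial ι ℂ :=
  letI := Fintype.ofFinite ι
  ∑ i, C (φ (b i)) * X i

theorem toFunction_linearPolynomial (b : Module.Basis ι ℂ W) (φ : Module.Dual ℂ W) :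
    toFunction b (linearPolynomial b φ) = φ := by
  let := Fintype.ofFinite ι
  funext w
  rw [toFunction_apply, linearPolynomial, map_sum]
  conv_rhs => rw [← b.sum_repr w, map_sum]
  refine Finset.sum_congr rfl fun i _ => ?_
  simp [mul_comm]

theorem isHomogeneous_linearPolynomial (b : Module.Basis ι ℂ W) (φ : Module.Dual ℂ W) :
    (linearPolynomial b φ).IsHomogeneous 1 :=
  IsHomogeneous.sum _ _ _ fun i _ => (isHomogeneous_X ℂ i).C_mul _

theorem range_toFunction (b : Module.Basis ι ℂ W) : (toFunction b).range = regularFunctions W := by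
  rw [toFunction, ← Algebra.adjoin_range_eq_range_aeval]
  refine le_antisymm (Algebra.adjoin_mono ?_) (Algebra.adjoin_le ?_)
  · rintro _ ⟨i, rfl⟩
    exact ⟨b.coord i, rfl⟩
  · rintro _ ⟨φ, rfl⟩
    rw [Algebra.adjoin_range_eq_range_aeval]
    exact ⟨linearPolynomial b φ, toFunction_linearPolynomial b φ⟩

variable {Γ : Type*} [Group Γ]

/-- The action on polynomials by linear substitutions that is induced by a representation. -/
noncomputable def polynomialAction (b : Module.Basis ι ℂ W) (ρ : Representation ℂ Γ W) (γ : Γ) :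
    MvPolynomial ι ℂ →ₐ[ℂ] MvPolynomial ι ℂ :=
  aeval fun i => linearPolynomial b (b.coord i ∘ₗ ρ γ⁻¹)

theorem toFunction_polynomialAction (b : Module.Basis ι ℂ W) (ρ : Representation ℂ Γ W) (γ : Γ)
    (p : MvPolynomial ι ℂ) (w : W) :
    toFunction b (polynomialAction b ρ γ p) w = toFunction b p (ρ γ⁻¹ w) := by
  induction p using MvPolynomial.induction_on with
  | C c => simp only [← algebraMap_eq, AlgHom.commutes]; rfl
  | add p q hp hq => simp only [map_add, Pi.add_apply, hp, hq]
  | mul_X p i hp =>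
    simp only [map_mul, Pi.mul_apply, hp]
    congr 1
    rw [polynomialAction, aeval_X, toFunction_linearPolynomial, toFunction, aeval_X]
    rfl

/-- `polynomialAction` as a homomorphism. -/
noncomputable def polynomialActionHom (b : Module.Basis ι ℂ W) (ρ : Representation ℂ Γ W) :
    Γ →* (MvPolynomial ι ℂ →ₐ[ℂ] MvPolynomial ι ℂ) where
  toFun := polynomialAction b ρ
  map_one' := AlgHom.ext fun p => toFunction_injective b <| funext fun w => by
    simp [toFunction_polynomialAction]
  map_mul' g h := AlgHom.ext fun p => toFunction_injective b <| funext fun w => by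
    simp [toFunction_polynomialAction]

theorem preservesDegree_polynomialActionHom (b : Module.Basis ι ℂ W) (ρ : Representation ℂ Γ W) :
    PreservesDegree (polynomialActionHom b ρ) := fun g n p hp => by
  have h := hp.aeval (fun i => linearPolynomial b (b.coord i ∘ₗ ρ g⁻¹))
    (fun i => isHomogeneous_linearPolynomial b _)
  rwa [one_mul] at h

theorem totalDegree_action_le {K σ : Type*} [Field K]
    {a : Γ →* (MvPolynomial σ K →ₐ[K] MvPolynomial σ K)} (ha : PreservesDegree a) (g : Γ)
    (p : MvPolynomial σ K) : (a g p).totalDegree ≤ p.totalDegree := by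
  conv_lhs => rw [← sum_homogeneousComponent p, map_sum]
  refine totalDegree_finsetSum_le fun i hi => ?_
  exact (ha g i _ (homogeneousComponent_isHomogeneous i p)).totalDegree_le.trans
    (Nat.lt_succ_iff.1 (Finset.mem_range.1 hi))

/-- Each coordinate changes by a multiple of the linear form `l` of the hyperplane, so the
substitution is the identity modulo `l`. The quotient loses one degree because `l` has degree one.
The element may also act trivially, in which case `l = 1` serves. -/
theorem actsByReflection_polynomialActionHom (b : Module.Basis ι ℂ W) (ρ : Representation ℂ Γ W)
    {s : Γ} (hs : ∃ φ : Module.Dual ℂ W, ∀ w, φ w = 0 → ρ s w = w) :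
    ActsByReflection (polynomialActionHom b ρ) s := by
  obtain ⟨φ, hφ⟩ := hs
  have hφ' : ∀ w, φ w = 0 → ρ s⁻¹ w = w := fun w hw => by
    conv_lhs => rw [← hφ w hw]
    simp [← Module.End.mul_apply, ← map_mul]
  by_cases h0 : φ = 0
  · refine ⟨1, one_ne_zero, fun p => ⟨0, ?_, Or.inl rfl⟩⟩
    rw [mul_zero, sub_eq_zero]
    refine toFunction_injective b (funext fun w => ?_)
    rw [show polynomialActionHom b ρ s p = polynomialAction b ρ s p from rfl,
      toFunction_polynomialAction, hφ' w (by rw [h0]; rfl)]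
  obtain ⟨w₀, hw₀⟩ : ∃ w₀, φ w₀ = 1 := by
    obtain ⟨w, hw⟩ := DFunLike.ne_iff.1 h0
    exact ⟨(φ w)⁻¹ • w, by simpa using inv_mul_cancel₀ hw⟩
  set v := ρ s⁻¹ w₀ - w₀ with hv
  have hform : ∀ w, ρ s⁻¹ w = w + φ w • v := fun w => by
    have h1 := hφ' (w - φ w • w₀) (by simp [hw₀])
    rw [map_sub, map_smul] at h1
    rw [hv, smul_sub]
    rw [sub_eq_iff_eq_add] at h1
    rw [h1]
    abel
  set l := linearPolynomial b φ with hl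
  have hl0 : l ≠ 0 := fun h => h0 <| by
    have h1 := toFunction_linearPolynomial b φ
    rw [← hl, h, map_zero] at h1
    exact DFunLike.coe_injective h1.symm
  have hX : ∀ i, polynomialAction b ρ s (X i) = X i + l * C (b.coord i v) := fun i => by
    refine toFunction_injective b (funext fun w => ?_)
    rw [toFunction_polynomialAction, hform, map_add, map_mul, Pi.add_apply, Pi.mul_apply, hl,
      toFunction_linearPolynomial]
    simp [toFunction, aeval_X]
  have hdvd : ∀ p, l ∣ p - polynomialAction b ρ s p := fun p => by
    have h1 : (Ideal.Quotient.mkₐ ℂ (Ideal.span {l})).comp (polynomialAction b ρ s) =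
        Ideal.Quotient.mkₐ ℂ (Ideal.span {l}) := by
      refine algHom_ext fun i => ?_
      rw [AlgHom.comp_apply, hX, map_add, map_mul]
      have h2 : Ideal.Quotient.mkₐ ℂ (Ideal.span {l}) l = 0 :=
        Ideal.Quotient.eq_zero_iff_mem.2 (Ideal.mem_span_singleton_self l)
      rw [h2, zero_mul, add_zero]
    have h2 := DFunLike.congr_fun h1 p
    exact Ideal.mem_span_singleton.1 (Ideal.Quotient.eq.1 h2.symm)
  refine ⟨l, hl0, fun p => ?_⟩
  obtain ⟨q, hq⟩ := hdvd p
  refine ⟨q, hq, or_iff_not_imp_left.2 fun hq0 => ?_⟩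
  have h1 := totalDegree_mul_of_isDomain hl0 hq0
  rw [(isHomogeneous_linearPolynomial b φ).totalDegree hl0, ← hq] at h1
  have h2 := totalDegree_sub p (polynomialAction b ρ s p)
  have h3 := totalDegree_action_le (preservesDegree_polynomialActionHom b ρ) s p
  rw [show polynomialActionHom b ρ s p = polynomialAction b ρ s p from rfl] at h3
  omega

theorem map_invariantPolynomials (b : Module.Basis ι ℂ W) (ρ : Representation ℂ Γ W) :
    (invariantPolynomials (polynomialActionHom b ρ)).map (toFunction b) =
      invariantFunctions ρ := by
  ext f
  constructor
  · rintro ⟨p, hp, rfl⟩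
    refine ⟨range_toFunction b ▸ ⟨p, rfl⟩, fun γ w => ?_⟩
    have h1 := toFunction_polynomialAction b ρ γ⁻¹ p w
    rw [inv_inv] at h1
    exact h1.symm.trans (congrArg (fun q => toFunction b q w) (hp γ⁻¹))
  · rintro ⟨hf, hinv⟩
    rw [← range_toFunction b] at hf
    obtain ⟨p, rfl⟩ := hf
    refine ⟨p, fun g => toFunction_injective b (funext fun w => ?_), rfl⟩
    exact (toFunction_polynomialAction b ρ g p w).trans (hinv g⁻¹ w)

end Coordinates

/-- The quotient of a finite-dimensional space by a finite group acting through a group generated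
by reflections is smooth. -/
theorem smooth_geometricQuotientStructure {Γ W : Type*} [Group Γ] [Finite Γ] [AddCommGroup W]
    [Module ℂ W] [FiniteDimensional ℂ W] (ρ : Representation ℂ Γ W)
    (hgen : ∀ γ, ∃ k ∈ Subgroup.closure
      {s | ∃ φ : Module.Dual ℂ W, ∀ w, φ w = 0 → ρ s w = w}, ρ γ = ρ k) :
    AlgebraicGeometry.Smooth (geometricQuotientStructure ρ) := by
  cases nonempty_fintype Γ
  let b := Module.finBasis ℂ W
  obtain ⟨F, hF, hadj⟩ := exists_algebraicIndependent_adjoin_eq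
    (preservesDegree_polynomialActionHom b ρ) (fun g => by
      obtain ⟨k, hk, h⟩ := hgen g
      refine ⟨k, Subgroup.closure_mono
        (fun s hs => actsByReflection_polynomialActionHom b ρ hs) hk, ?_⟩
      refine AlgHom.ext fun p => toFunction_injective b (funext fun w => ?_)
      have hinv : ρ g⁻¹ = ρ k⁻¹ :=
        calc ρ g⁻¹ = ρ g⁻¹ * (ρ k * ρ k⁻¹) := by rw [← map_mul, mul_inv_cancel, map_one, mul_one]
          _ = ρ k⁻¹ := by rw [← h, ← mul_assoc, ← map_mul, inv_mul_cancel, map_one, one_mul]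
      exact (toFunction_polynomialAction b ρ g p w).trans
        ((congrArg (fun e : W →ₗ[ℂ] W => toFunction b p (e w)) hinv).trans
          (toFunction_polynomialAction b ρ k p w).symm))
  have hind := hF.map' (f := toFunction b) (toFunction_injective b)
  have hadj' : Algebra.adjoin ℂ (Set.range (toFunction b ∘ ((↑) : F → MvPolynomial _ ℂ))) =
      invariantFunctions ρ := by
    rw [← map_invariantPolynomials b ρ, ← hadj, AlgHom.map_adjoin, Set.range_comp,
      Subtype.range_coe]
  have e := hind.aevalEquiv.trans (Subalgebra.equivOfEq _ _ hadj')
  have : Algebra.Smooth ℂ (MvPolynomial F ℂ) := { }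
  have : Algebra.Smooth ℂ (invariantFunctions ρ) := .of_equiv e
  -- The universe lift of `ℂ` contributes an isomorphism, which is harmless.
  exact (AlgebraicGeometry.HasRingHomProperty.Spec_iff (P := @AlgebraicGeometry.Smooth)).2 <|
    (RingHom.Smooth.of_bijective ULift.ringEquiv.bijective).comp
    (RingHom.smooth_algebraMap.2 this)

end ReflQuot

namespace ReflQuot

/-! ### Reduction to generation by reflections on fixed spaces. -/

section FixedSpaces

variable {K V : Type*} [Field K] [AddCommGroup V] [Module K V]

/-- On the fixed space of `g`, every element of `G` commuting with `g` agrees with a product of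
elements of `G` that commute with `g` and fix a hyperplane (or everything) in that space. -/
def GeneratedOnFixed (G : Subgroup (V ≃ₗ[K] V)) (g : V ≃ₗ[K] V) : Prop :=
  ∀ h ∈ G, h * g = g * h → ∃ k ∈ Subgroup.closure
    {t : V ≃ₗ[K] V | t ∈ G ∧ t * g = g * t ∧
      ∃ φ : Module.Dual K V, ∀ x, g x = x → φ x = 0 → t x = x}, ∀ x, g x = x → h x = k x

theorem mem_fixedBy {G : Subgroup (V ≃ₗ[K] V)} {x : V} :
    x ∈ fixedBy G ↔ ∀ g ∈ G, g x = x := by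
  simp [fixedBy]

theorem fixedBy_le {G : Subgroup (V ≃ₗ[K] V)} {g : V ≃ₗ[K] V} (hg : g ∈ G) :
    fixedBy G ≤ (g : V →ₗ[K] V).fixedSubmodule := fun x hx => by
  rw [LinearMap.mem_fixedSubmodule_iff]
  exact mem_fixedBy.1 hx g hg

variable [FiniteDimensional K V]

/-- A subspace of codimension at most one in `B` is cut out in `B` by a functional. -/
theorem exists_dual_of_finrank_le {A B : Submodule K V} (hAB : A ≤ B)
    (h : Module.finrank K B ≤ Module.finrank K A + 1) :
    ∃ φ : Module.Dual K V, ∀ x ∈ B, φ x = 0 → x ∈ A := by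
  by_cases hBA : B ≤ A
  · exact ⟨0, fun x hx _ => hBA hx⟩
  obtain ⟨b, hb, hbA⟩ := SetLike.not_le_iff_exists.1 hBA
  obtain ⟨φ, hφ, hker⟩ := Submodule.exists_le_ker_of_notMem hbA
  have h1 : A ≤ B ⊓ LinearMap.ker φ := le_inf hAB hker
  have h2 : B ⊓ LinearMap.ker φ < B :=
    lt_of_le_of_ne inf_le_left fun h => hφ (h.symm ▸ hb : b ∈ B ⊓ LinearMap.ker φ).2
  have h3 := Submodule.finrank_lt_finrank_of_lt h2
  have h4 := Submodule.eq_of_le_of_finrank_le h1 (by omega)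
  exact ⟨φ, fun x hx h0 => h4.symm ▸ (⟨hx, h0⟩ : x ∈ B ⊓ LinearMap.ker φ)⟩

theorem exists_dual_of_isReflection {s : V ≃ₗ[K] V} (hs : IsReflection s) :
    ∃ φ : Module.Dual K V, ∀ x, φ x = 0 → s x = x := by
  have h1 := Submodule.finrank_quotient_add_finrank (s : V →ₗ[K] V).fixedSubmodule
  rw [IsReflection] at hs
  have h2 : Module.finrank K (⊤ : Submodule K V) ≤
      Module.finrank K (s : V →ₗ[K] V).fixedSubmodule + 1 := by
    rw [finrank_top]
    omega
  obtain ⟨φ, hφ⟩ := exists_dual_of_finrank_le le_top h2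
  exact ⟨φ, fun x hx => LinearMap.mem_fixedSubmodule_iff.1 (hφ x Submodule.mem_top hx)⟩

theorem generatedOnFixed_one {G : Subgroup (V ≃ₗ[K] V)} (hG : IsReflectionGroup G) :
    GeneratedOnFixed G 1 := by
  intro h hh _
  refine ⟨h, ?_, fun _ _ => rfl⟩
  rw [← hG.2] at hh
  refine Subgroup.closure_mono ?_ hh
  rintro s ⟨hs, hsr⟩
  obtain ⟨φ, hφ⟩ := exists_dual_of_isReflection hsr
  exact ⟨hs, by simp, φ, fun x _ => hφ x⟩

/-- Every element of `G` fixes `V^G`, which here has codimension at most one in `V^g`; so each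
commuting element is itself one of the generators. -/
theorem generatedOnFixed_of_finrank_le {G : Subgroup (V ≃ₗ[K] V)} {g : V ≃ₗ[K] V} (hg : g ∈ G)
    (h : Module.finrank K (g : V →ₗ[K] V).fixedSubmodule ≤ Module.finrank K (fixedBy G) + 1) :
    GeneratedOnFixed G g := by
  obtain ⟨φ, hφ⟩ := exists_dual_of_finrank_le (fixedBy_le hg) h
  intro t ht htg
  refine ⟨t, Subgroup.subset_closure ⟨ht, htg, φ, fun x hx h0 => ?_⟩, fun _ _ => rfl⟩
  exact mem_fixedBy.1 (hφ x (LinearMap.mem_fixedSubmodule_iff.2 hx) h0) t ht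

theorem finrank_fixed_lt {g : V ≃ₗ[K] V} (hg : g ≠ 1) :
    Module.finrank K (g : V →ₗ[K] V).fixedSubmodule < Module.finrank K V := by
  refine Submodule.finrank_lt fun h => hg ?_
  ext x
  exact LinearMap.mem_fixedSubmodule_iff.1 (h ▸ Submodule.mem_top :
    x ∈ (g : V →ₗ[K] V).fixedSubmodule)

theorem finrank_fixedBy_add_rank (G : Subgroup (V ≃ₗ[K] V)) :
    Module.finrank K (fixedBy G) + rank G = Module.finrank K V := by
  rw [rank, add_comm, Submodule.finrank_quotient_add_finrank]

theorem generatedOnFixed_of_rank_le_two {G : Subgroup (V ≃ₗ[K] V)} (hG : IsReflectionGroup G)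
    (hr : rank G ≤ 2) {g : V ≃ₗ[K] V} (hg : g ∈ G) : GeneratedOnFixed G g := by
  by_cases h1 : g = 1
  · rw [h1]
    exact generatedOnFixed_one hG
  · have h2 := finrank_fixed_lt h1
    have h3 := finrank_fixedBy_add_rank G
    exact generatedOnFixed_of_finrank_le hg (by omega)

end FixedSpaces

/-- Transports the condition on automorphisms of `V` to the representation of the centralizer on
`V^g`, which need not be faithful. -/
theorem smoothFixedQuotient_of_generatedOnFixed {V : Type*} [AddCommGroup V] [Module ℂ V]
    [FiniteDimensional ℂ V] {G : Subgroup (V ≃ₗ[ℂ] V)} [Finite G] (g : G)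
    (hg : GeneratedOnFixed G (g : V ≃ₗ[ℂ] V)) : SmoothFixedQuotient G g := by
  refine smooth_geometricQuotientStructure (centralizerRep G g) fun γ => ?_
  have hcomm : ∀ h : G, h ∈ Subgroup.centralizer ({g} : Set G) ↔
      (h : V ≃ₗ[ℂ] V) * g = g * h := fun h => by
    rw [Subgroup.mem_centralizer_singleton_iff]
    exact Subtype.ext_iff
  obtain ⟨k, hk, hγ⟩ := hg γ γ.1.2 ((hcomm _).1 γ.2)
  let ι : Subgroup.centralizer ({g} : Set G) →* (V ≃ₗ[ℂ] V) :=
    G.subtype.comp (Subgroup.subtype _)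
  have hk' : k ∈ (Subgroup.closure {s | ∃ φ : Module.Dual ℂ _, ∀ w, φ w = 0 →
      centralizerRep G g s w = w}).map ι := by
    rw [MonoidHom.map_closure]
    refine Subgroup.closure_mono ?_ hk
    rintro t ⟨ht, htg, φ, hφ⟩
    refine ⟨⟨⟨t, ht⟩, (hcomm _).2 htg⟩, ⟨φ.domRestrict _, fun w hw => ?_⟩, rfl⟩
    exact Subtype.ext (hφ w (LinearMap.mem_fixedSubmodule_iff.1 w.2) hw)
  obtain ⟨k', hk', rfl⟩ := hk'
  refine ⟨k', hk', LinearMap.ext fun w => Subtype.ext ?_⟩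
  exact hγ w (LinearMap.mem_fixedSubmodule_iff.1 w.2)

/-! ### Extension of scalars from `ℝ` to `ℂ`. -/

section Complexification

variable {U : Type*} [AddCommGroup U] [Module ℝ U]

theorem complexifyHom_apply (g : U ≃ₗ[ℝ] U) (x : ℂ ⊗[ℝ] U) :
    complexifyHom U g x = (g : U →ₗ[ℝ] U).baseChange ℂ x := rfl

theorem complexifyHom_injective : Function.Injective (complexifyHom U) := by
  intro g h hgh
  ext x
  have h1 := congrArg (fun e : (ℂ ⊗[ℝ] U) ≃ₗ[ℂ] (ℂ ⊗[ℝ] U) => e ((1 : ℂ) ⊗ₜ[ℝ] x)) hgh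
  simp only [complexifyHom_apply, LinearMap.baseChange_tmul] at h1
  have h2 := congrArg (TensorProduct.lid ℝ U ∘ LinearMap.rTensor U Complex.reLm) h1
  simpa using h2

/-- Linear maps that agree on the fixed space of an element `g` of finite order still agree on the
fixed space of `g` after extension of scalars. -/
theorem baseChange_eq_of_fixed {g : U ≃ₗ[ℝ] U} (hg : IsOfFinOrder g) {A B : U →ₗ[ℝ] U}
    (hAB : ∀ x, g x = x → A x = B x) {v : ℂ ⊗[ℝ] U} (hv : complexifyHom U g v = v) :
    A.baseChange ℂ v = B.baseChange ℂ v := by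
  obtain ⟨m, hm, hgm⟩ := isOfFinOrder_iff_pow_eq_one.1 hg
  let e : Module.End ℝ U := (g : U →ₗ[ℝ] U)
  have hem : e ^ m = 1 := by
    have h1 := congrArg (LinearEquiv.automorphismGroup.toLinearMapMonoidHom (R := ℝ) (M := U)) hgm
    rwa [map_pow, map_one] at h1
  -- The average of the powers of `g` projects onto its fixed space. Agreement there becomes the
  -- linear identity `A ∘ E = B ∘ E`, which survives base change.
  let E : Module.End ℝ U := (m : ℝ)⁻¹ • ∑ i ∈ Finset.range m, e ^ i
  have hE : ∀ x, g (E x) = E x := fun x => by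
    have h1 := mul_geom_sum e m
    rw [hem, sub_self, sub_mul, one_mul, sub_eq_zero] at h1
    have h2 : e * E = E := by
      rw [mul_smul_comm, h1]
    exact DFunLike.congr_fun h2 x
  have hABE : A ∘ₗ E = B ∘ₗ E := LinearMap.ext fun x => hAB _ (hE x)
  have hEv : E.baseChange ℂ v = v := by
    have h1 : ∀ i, (Module.End.baseChangeHom ℝ ℂ U (e ^ i)) v = v := fun i => by
      rw [map_pow]
      induction i with
      | zero => rfl
      | succ i ih => rw [pow_succ, Module.End.mul_apply]; exact (congrArg _ hv).trans ih
    show Module.End.baseChangeHom ℝ ℂ U E v = v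
    rw [map_smul, map_sum, LinearMap.smul_apply, LinearMap.sum_apply,
      Finset.sum_congr rfl fun i _ => h1 i, Finset.sum_const, Finset.card_range,
      ← Nat.cast_smul_eq_nsmul ℝ, smul_smul, inv_mul_cancel₀ (Nat.cast_ne_zero.2 hm.ne'), one_smul]
  have h3 := congrArg (fun f : U →ₗ[ℝ] U => f.baseChange ℂ v) hABE
  simp only [LinearMap.baseChange_comp, LinearMap.comp_apply, hEv] at h3
  exact h3

theorem generatedOnFixed_complexify {G : Subgroup (U ≃ₗ[ℝ] U)} {g : U ≃ₗ[ℝ] U}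
    (hfin : IsOfFinOrder g) (hg : GeneratedOnFixed G g) :
    GeneratedOnFixed (complexify G) (complexifyHom U g) := by
  rintro _ ⟨h, hh, rfl⟩ hcomm
  rw [← map_mul, ← map_mul] at hcomm
  obtain ⟨k, hk, hhk⟩ := hg h hh (complexifyHom_injective hcomm)
  refine ⟨complexifyHom U k, ?_, fun x hx => baseChange_eq_of_fixed hfin hhk hx⟩
  have h1 := Subgroup.mem_map_of_mem (complexifyHom U) hk
  rw [MonoidHom.map_closure] at h1
  refine Subgroup.closure_mono ?_ h1
  rintro _ ⟨t, ⟨ht, htg, φ, hφ⟩, rfl⟩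
  refine ⟨Subgroup.mem_map_of_mem _ ht, by rw [← map_mul, htg, map_mul],
    (TensorProduct.AlgebraTensorModule.rid ℝ ℂ ℂ).toLinearMap ∘ₗ
      LinearMap.baseChange ℂ (φ : U →ₗ[ℝ] ℝ),
    fun v hv hφv => ?_⟩
  -- Fixing a hyperplane is an implication and does not tensor directly. It is recast as `t = id +
  -- φ(·) a` on the fixed space, an equality of linear maps.
  obtain ⟨a, ha⟩ : ∃ a : U, ∀ x, g x = x →
      (t : U →ₗ[ℝ] U) x = (LinearMap.id + LinearMap.toSpanSingleton ℝ U a ∘ₗ φ : U →ₗ[ℝ] U) x := by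
    by_cases h0 : ∃ x, g x = x ∧ φ x ≠ 0
    · obtain ⟨x₀, hx₀, hφ₀⟩ := h0
      refine ⟨(φ x₀)⁻¹ • (t x₀ - x₀), fun x hx => ?_⟩
      have h1 := hφ (x - (φ x * (φ x₀)⁻¹) • x₀) (by simp [hx, hx₀]) (by simp [hφ₀])
      simp only [map_sub, map_smul] at h1
      rw [sub_eq_iff_eq_add] at h1
      simp only [LinearEquiv.coe_coe, LinearMap.add_apply, LinearMap.id_apply,
        LinearMap.comp_apply, LinearMap.toSpanSingleton_apply, smul_smul, smul_sub]
      rw [h1]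
      abel
    · push Not at h0
      exact ⟨0, fun x hx => by simpa using hφ x hx (h0 x hx)⟩
  have h2 := baseChange_eq_of_fixed hfin ha hv
  have h3 : LinearMap.baseChange ℂ (φ : U →ₗ[ℝ] ℝ) v = 0 := by
    simpa using hφv
  rw [complexifyHom_apply, h2, LinearMap.baseChange_add, LinearMap.baseChange_comp,
    LinearMap.add_apply, LinearMap.comp_apply, h3, map_zero, add_zero, LinearMap.baseChange_id]
  rfl

theorem smoothFixedQuotient_complexify [FiniteDimensional ℝ U] {G : Subgroup (U ≃ₗ[ℝ] U)}
    [Finite G] (hG : ∀ g ∈ G, GeneratedOnFixed G g) (g : complexify G) :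
    SmoothFixedQuotient (complexify G) g := by
  have : Finite (complexify G) := Finite.Set.finite_image (G : Set (U ≃ₗ[ℝ] U)) (complexifyHom U)
  refine smoothFixedQuotient_of_generatedOnFixed g ?_
  obtain ⟨_, g, hg, rfl⟩ := g
  exact generatedOnFixed_complexify
    (Submonoid.isOfFinOrder_coe.2 (isOfFinOrder_of_finite (⟨g, hg⟩ : G))) (hG g hg)

end Complexification

end ReflQuot

namespace ReflQuot

/-! ### Root systems, bases, the exchange condition and Steinberg's theorem. -/

section RootSystems

variable {U : Type*} [AddCommGroup U] [Module ℝ U]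

open Classical in
/-- The orthogonal reflection in a vector `α` with `B α α = 2` (the identity for other `α`). -/
noncomputable def rootReflection (B : LinearMap.BilinForm ℝ U) (α : U) : U ≃ₗ[ℝ] U :=
  if h : B α α = 2 then Module.reflection (f := B α) h else 1

theorem rootReflection_apply {B : LinearMap.BilinForm ℝ U} {α : U} (h : B α α = 2) (x : U) :
    rootReflection B α x = x - B α x • α := by
  rw [rootReflection, dif_pos h, Module.reflection_apply]

theorem rootReflection_self {B : LinearMap.BilinForm ℝ U} {α : U} (h : B α α = 2) :
    rootReflection B α α = -α := by
  rw [rootReflection_apply h, h, two_smul]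
  abel

theorem rootReflection_mul_self {B : LinearMap.BilinForm ℝ U} {α : U} (h : B α α = 2) :
    rootReflection B α * rootReflection B α = 1 := by
  ext x
  rw [LinearEquiv.mul_apply, rootReflection_apply h x, map_sub, map_smul, rootReflection_self h,
    rootReflection_apply h x]
  simp

theorem rootReflection_inv {B : LinearMap.BilinForm ℝ U} {α : U} (h : B α α = 2) :
    (rootReflection B α)⁻¹ = rootReflection B α :=
  inv_eq_of_mul_eq_one_left (rootReflection_mul_self h)

theorem rootReflection_isometry {B : LinearMap.BilinForm ℝ U} (hB : ∀ x y, B x y = B y x) {α : U}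
    (h : B α α = 2) (x y : U) : B (rootReflection B α x) (rootReflection B α y) = B x y := by
  simp only [rootReflection_apply h, map_sub, map_smul, LinearMap.sub_apply, LinearMap.smul_apply,
    smul_eq_mul, h, hB x α]
  ring

theorem conj_rootReflection {B : LinearMap.BilinForm ℝ U} {g : U ≃ₗ[ℝ] U}
    (hg : ∀ x y, B (g x) (g y) = B x y) {α : U} (h : B α α = 2) :
    g * rootReflection B α = rootReflection B (g α) * g := by
  ext x
  rw [LinearEquiv.mul_apply, LinearEquiv.mul_apply, rootReflection_apply h,
    rootReflection_apply (by rw [hg, h]), hg, map_sub, map_smul]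

/-- A finite set of vectors of norm `2` that is stable under the reflections it defines. -/
structure IsRootSystem (B : LinearMap.BilinForm ℝ U) (Φ : Set U) : Prop where
  symm : ∀ x y, B x y = B y x
  finite : Φ.Finite
  norm : ∀ α ∈ Φ, B α α = 2
  stable : ∀ α ∈ Φ, ∀ β ∈ Φ, rootReflection B α β ∈ Φ

variable {B : LinearMap.BilinForm ℝ U} {Φ : Set U}

theorem IsRootSystem.neg_mem (h : IsRootSystem B Φ) {α : U} (hα : α ∈ Φ) : -α ∈ Φ := by
  rw [← rootReflection_self (h.norm α hα)]
  exact h.stable α hα α hα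

theorem IsRootSystem.ne_zero (h : IsRootSystem B Φ) {α : U} (hα : α ∈ Φ) : α ≠ 0 := by
  rintro rfl
  simpa using h.norm 0 hα

/-- A base of a root system: every positive root is a combination of base roots with nonnegative
coefficients, and no base root is such a combination of the others. -/
structure IsBase (Φ : Set U) (ht : Module.Dual ℝ U) (Δ : Finset U) : Prop where
  subset : ∀ δ ∈ Δ, δ ∈ Φ
  pos : ∀ δ ∈ Δ, 0 < ht δ
  cone : ∀ β ∈ Φ, 0 < ht β → ∃ m : U → ℝ, (∀ δ, 0 ≤ m δ) ∧ β = ∑ δ ∈ Δ, m δ • δ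
  irredundant : ∀ δ ∈ Δ, ∀ m : U → ℝ, (∀ γ, 0 ≤ m γ) → ∀ a : ℝ, 0 < a → a • δ ≠
    ∑ γ ∈ (open Classical in Δ.erase δ), m γ • γ

/-- A minimal set of positive roots whose cone contains all positive roots will do. Linear
independence is not needed: irredundancy for nonnegative combinations suffices. -/
theorem exists_isBase (hΦ : Φ.Finite) (ht : Module.Dual ℝ U) : ∃ Δ, IsBase Φ ht Δ := by
  classical
  let Q : Finset U → Prop := fun Δ => (∀ δ ∈ Δ, δ ∈ Φ ∧ 0 < ht δ) ∧
    ∀ β ∈ Φ, 0 < ht β → ∃ m : U → ℝ, (∀ δ, 0 ≤ m δ) ∧ β = ∑ δ ∈ Δ, m δ • δ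
  have hQ : Q (hΦ.toFinset.filter fun β => 0 < ht β) := by
    refine ⟨fun δ hδ => by simpa using hδ, fun β hβ hpos =>
      ⟨fun γ => if γ = β then 1 else 0, fun δ => ?_, ?_⟩⟩
    · dsimp only
      split_ifs <;> norm_num
    · simp [hβ, hpos]
  obtain ⟨Δ, hΔ, hmin⟩ := exists_minimal_of_wellFoundedLT Q ⟨_, hQ⟩
  refine ⟨Δ, fun δ hδ => (hΔ.1 δ hδ).1, fun δ hδ => (hΔ.1 δ hδ).2, hΔ.2, ?_⟩
  intro δ hδ m hm a ha heq
  have h1 : Q (Δ.erase δ) := by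
    refine ⟨fun γ hγ => hΔ.1 γ (Finset.mem_of_mem_erase hγ), fun β hβ hpos => ?_⟩
    obtain ⟨n, hn, hβn⟩ := hΔ.2 β hβ hpos
    refine ⟨fun γ => n γ + n δ * a⁻¹ * m γ, fun γ => ?_, ?_⟩
    · have := hn γ; have := hn δ; have := hm γ
      positivity
    · simp only [add_smul, Finset.sum_add_distrib, mul_smul, ← Finset.smul_sum]
      convert hβn using 1
      rw [← Finset.add_sum_erase _ _ hδ, add_comm]
      congr 2
      convert inv_smul_smul₀ ha.ne' δ using 2
      convert heq.symm
  exact Finset.notMem_erase δ Δ (hmin h1 (Finset.erase_subset _ _) hδ)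

/-- A simple reflection permutes the positive roots other than its own. -/
theorem pos_rootReflection (h : IsRootSystem B Φ) {ht : Module.Dual ℝ U}
    (hne : ∀ α ∈ Φ, ht α ≠ 0) {Δ : Finset U} (hΔ : IsBase Φ ht Δ) {δ β : U} (hδ : δ ∈ Δ)
    (hβ : β ∈ Φ) (hpos : 0 < ht β) (hβδ : β ≠ δ) : 0 < ht (rootReflection B δ β) := by
  classical
  have hδn := h.norm δ (hΔ.subset δ hδ)
  have hsβ := h.stable δ (hΔ.subset δ hδ) β hβ
  by_contra hneg
  have hneg' : 0 < ht (-rootReflection B δ β) := by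
    rw [map_neg]
    exact neg_pos.2 (lt_of_le_of_ne (not_lt.1 hneg) (hne _ hsβ))
  obtain ⟨m, hm, hβm⟩ := hΔ.cone β hβ hpos
  obtain ⟨n, hn, hβn⟩ := hΔ.cone _ (h.neg_mem hsβ) hneg'
  -- Adding the expansions of the positive roots `β` and `-s_δ β` gives a multiple of `δ`;
  -- collecting `δ` on the left leaves a nonnegative combination of the other base roots.
  have hrel : (B δ β - m δ - n δ) • δ = ∑ γ ∈ Δ.erase δ, (m γ + n γ) • γ := by
    have h1 : B δ β • δ = ∑ γ ∈ Δ, (m γ + n γ) • γ := by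
      simp only [add_smul, Finset.sum_add_distrib]
      rw [← hβm, ← hβn, rootReflection_apply hδn]
      abel
    rw [← Finset.add_sum_erase _ _ hδ] at h1
    rw [sub_sub, sub_smul, h1, add_sub_cancel_left]
  have hmn : ∀ γ, 0 ≤ m γ + n γ := fun γ => add_nonneg (hm γ) (hn γ)
  rcases lt_or_ge 0 (B δ β - m δ - n δ) with ha | ha
  · refine hΔ.irredundant δ hδ _ hmn _ ha ?_
    convert hrel
  -- With a nonpositive coefficient on the left, comparing heights kills every term on the right. So
  -- `β` is a nonnegative multiple of `δ`, and equal norms force `β = δ`.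
  have hsum : ∑ γ ∈ Δ.erase δ, (m γ + n γ) * ht γ ≤ 0 := by
    have h1 := congrArg ht hrel
    simp only [map_smul, map_sum, smul_eq_mul] at h1
    rw [← h1]
    exact mul_nonpos_of_nonpos_of_nonneg ha (hΔ.pos δ hδ).le
  have hterm : ∀ γ ∈ Δ.erase δ, 0 ≤ (m γ + n γ) * ht γ := fun γ hγ =>
    mul_nonneg (hmn γ) (hΔ.pos γ (Finset.mem_of_mem_erase hγ)).le
  have hzero := (Finset.sum_eq_zero_iff_of_nonneg hterm).1
    (le_antisymm hsum (Finset.sum_nonneg hterm))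
  have hβ' : β = m δ • δ := by
    rw [hβm, ← Finset.add_sum_erase _ _ hδ, Finset.sum_eq_zero, add_zero]
    intro γ hγ
    have h1 := (mul_eq_zero.1 (hzero γ hγ)).resolve_right
      (hΔ.pos γ (Finset.mem_of_mem_erase hγ)).ne'
    have h2 : m γ = 0 := by linarith [hm γ, hn γ]
    rw [h2, zero_smul]
  have hnorm := h.norm β hβ
  rw [hβ', map_smul, map_smul, LinearMap.smul_apply, hδn, smul_eq_mul, smul_eq_mul] at hnorm
  have hm1 : m δ = 1 := by nlinarith [hm δ]
  rw [hm1, one_smul] at hβ'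
  exact hβδ hβ'

/-- The simple reflections generate all reflections in roots. -/
theorem rootReflection_mem_closure_base (h : IsRootSystem B Φ) {ht : Module.Dual ℝ U}
    (hne : ∀ α ∈ Φ, ht α ≠ 0) {Δ : Finset U} (hΔ : IsBase Φ ht Δ) {β : U} (hβ : β ∈ Φ)
    (hpos : 0 < ht β) :
    rootReflection B β ∈ Subgroup.closure (rootReflection B '' (Δ : Set U)) := by
  by_contra hcon
  -- A counterexample of least height pairs positively with some base root `δ`, because its norm is
  -- positive. Then `s_δ γ` is positive and lower, and its reflection is conjugate to that of `γ`.
  obtain ⟨γ, ⟨hγ, hγpos, hγW⟩, hmin⟩ := Set.exists_min_image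
    {γ | γ ∈ Φ ∧ 0 < ht γ ∧
      rootReflection B γ ∉ Subgroup.closure (rootReflection B '' (Δ : Set U))}
    ht (h.finite.subset fun γ hγ => hγ.1) ⟨β, hβ, hpos, hcon⟩
  obtain ⟨m, hm, hγm⟩ := hΔ.cone γ hγ hγpos
  obtain ⟨δ, hδ, hδγ⟩ : ∃ δ ∈ Δ, 0 < B δ γ := by
    by_contra! hle
    have h1 := h.norm γ hγ
    have h2 : B γ γ = ∑ δ ∈ Δ, m δ * B δ γ := by
      conv_lhs => rw [h.symm]; enter [1, 2]; rw [hγm]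
      simp
    have h3 : ∑ δ ∈ Δ, m δ * B δ γ ≤ 0 := Finset.sum_nonpos fun δ hδ =>
      mul_nonpos_of_nonneg_of_nonpos (hm δ) (hle δ hδ)
    linarith
  have hδΦ := hΔ.subset δ hδ
  have hδn := h.norm δ hδΦ
  have hδW : rootReflection B δ ∈ Subgroup.closure (rootReflection B '' (Δ : Set U)) :=
    Subgroup.subset_closure ⟨δ, hδ, rfl⟩
  have hne' : γ ≠ δ := by
    rintro rfl
    exact hγW hδW
  have hpos' := pos_rootReflection h hne hΔ hδ hγ hγpos hne'
  by_cases hW : rootReflection B (rootReflection B δ γ) ∈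
      Subgroup.closure (rootReflection B '' (Δ : Set U))
  · apply hγW
    have h1 := conj_rootReflection (rootReflection_isometry h.symm hδn) (h.norm γ hγ)
    have h2 : rootReflection B γ = rootReflection B δ *
        (rootReflection B (rootReflection B δ γ) * rootReflection B δ) := by
      rw [← h1, ← mul_assoc, rootReflection_mul_self hδn, one_mul]
    rw [h2]
    exact mul_mem hδW (mul_mem hW hδW)
  · have h1 := hmin _ ⟨h.stable δ hδΦ γ hγ, hpos', hW⟩
    rw [rootReflection_apply hδn, map_sub, map_smul, smul_eq_mul] at h1
    nlinarith [mul_pos hδγ (hΔ.pos δ hδ)]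

/-- The product of the reflections in a list of roots. -/
noncomputable def reflectionWord (B : LinearMap.BilinForm ℝ U) (l : List U) : U ≃ₗ[ℝ] U :=
  (l.map (rootReflection B)).prod

theorem reflectionWord_isometry (h : IsRootSystem B Φ) {l : List U} (hl : ∀ α ∈ l, α ∈ Φ)
    (x y : U) : B (reflectionWord B l x) (reflectionWord B l y) = B x y := by
  induction l with
  | nil => rfl
  | cons α l ih =>
    rw [List.forall_mem_cons] at hl
    exact (rootReflection_isometry h.symm (h.norm α hl.1) _ _).trans (ih hl.2)

theorem reflectionWord_mem (h : IsRootSystem B Φ) {l : List U} (hl : ∀ α ∈ l, α ∈ Φ) {β : U}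
    (hβ : β ∈ Φ) : reflectionWord B l β ∈ Φ := by
  induction l with
  | nil => exact hβ
  | cons α l ih =>
    rw [List.forall_mem_cons] at hl
    exact h.stable α hl.1 _ (ih hl.2)

theorem exists_reflectionWord {Δ : Set U} (hΔ : ∀ δ ∈ Δ, B δ δ = 2) {g : U ≃ₗ[ℝ] U}
    (hg : g ∈ Subgroup.closure (rootReflection B '' Δ)) :
    ∃ l : List U, (∀ δ ∈ l, δ ∈ Δ) ∧ g = reflectionWord B l := by
  induction hg using Subgroup.closure_induction with
  | mem s hs =>
    obtain ⟨δ, hδ, rfl⟩ := hs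
    exact ⟨[δ], by simpa using hδ, by simp [reflectionWord]⟩
  | one => exact ⟨[], by simp, rfl⟩
  | mul g k _ _ hg hk =>
    obtain ⟨l, hl, rfl⟩ := hg
    obtain ⟨m, hm, rfl⟩ := hk
    refine ⟨l ++ m, fun δ hδ => (List.mem_append.1 hδ).elim (hl δ) (hm δ), ?_⟩
    simp [reflectionWord]
  | inv g _ hg =>
    obtain ⟨l, hl, rfl⟩ := hg
    refine ⟨l.reverse, fun δ hδ => hl δ (List.mem_reverse.1 hδ), ?_⟩
    rw [reflectionWord, reflectionWord, List.prod_inv_reverse, List.map_map, List.map_reverse]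
    congr 2
    exact List.map_congr_left fun δ hδ => rootReflection_inv (hΔ δ (hl δ hδ))

/-- The exchange condition. -/
theorem exists_shorter_word (h : IsRootSystem B Φ) {ht : Module.Dual ℝ U}
    (hne : ∀ α ∈ Φ, ht α ≠ 0) {Δ : Finset U} (hΔ : IsBase Φ ht Δ) {δ : U} (hδ : δ ∈ Δ)
    {l : List U} (hl : ∀ γ ∈ l, γ ∈ Δ) (hneg : ht (reflectionWord B l δ) < 0) :
    ∃ l' : List U, (∀ γ ∈ l', γ ∈ Δ) ∧ l'.length + 1 = l.length ∧
      reflectionWord B l * rootReflection B δ = reflectionWord B l' := by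
  induction l with
  | nil => exact absurd (hΔ.pos δ hδ) (not_lt.2 (le_of_lt hneg))
  | cons γ l ih =>
    rw [List.forall_mem_cons] at hl
    have hlΦ : ∀ α ∈ l, α ∈ Φ := fun α hα => hΔ.subset α (hl.2 α hα)
    have hcons : ∀ m, reflectionWord B (γ :: m) = rootReflection B γ * reflectionWord B m :=
      fun m => by simp [reflectionWord]
    have hβ := reflectionWord_mem h hlΦ (hΔ.subset δ hδ)
    rcases lt_or_gt_of_ne (hne _ hβ) with hlt | hgt
    · obtain ⟨l', hl', hlen, hw⟩ := ih hl.2 hlt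
      refine ⟨γ :: l', List.forall_mem_cons.2 ⟨hl.1, hl'⟩, by simp [hlen], ?_⟩
      rw [hcons, hcons, mul_assoc, hw]
    · have hβγ : reflectionWord B l δ = γ := by
        by_contra hβγ
        have h1 := pos_rootReflection h hne hΔ hl.1 hβ hgt hβγ
        rw [hcons, LinearEquiv.mul_apply] at hneg
        exact lt_asymm h1 hneg
      refine ⟨l, hl.2, rfl, ?_⟩
      have h1 := conj_rootReflection (reflectionWord_isometry h hlΦ)
        (h.norm δ (hΔ.subset δ hδ))
      rw [hβγ] at h1
      rw [hcons, ← h1, mul_assoc, rootReflection_mul_self (h.norm δ (hΔ.subset δ hδ)), mul_one]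

/-- A small generic perturbation of `B v` vanishes on no root and keeps every nonzero sign of `B v`;
thus `v` lies in the closed dominant chamber. -/
theorem exists_dominating_height [FiniteDimensional ℝ U] (h : IsRootSystem B Φ) (v : U) :
    ∃ ht : Module.Dual ℝ U, ∀ α ∈ Φ, ht α ≠ 0 ∧ (0 < ht α → 0 ≤ B α v) := by
  have : Finite Φ := h.finite
  obtain ⟨f, hf⟩ := Module.exists_dual_forall_apply_ne_zero (K := ℝ) (fun α : Φ => (α : U))
    fun α => h.ne_zero α.2
  have key : ∀ α ∈ Φ, ∀ᶠ ε : ℝ in nhdsWithin 0 (Set.Ioi 0),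
      B α v + ε * f α ≠ 0 ∧ (0 < B α v + ε * f α → 0 ≤ B α v) := by
    intro α hα
    have hlim : Filter.Tendsto (fun ε : ℝ => B α v + ε * f α) (nhdsWithin 0 (Set.Ioi 0))
        (nhds (B α v)) := by
      have hc : Continuous fun ε : ℝ => B α v + ε * f α := by fun_prop
      simpa using (hc.tendsto 0).mono_left nhdsWithin_le_nhds
    rcases lt_trichotomy (B α v) 0 with hlt | heq | hgt
    · filter_upwards [hlim.eventually_lt_const hlt] with ε hε
      exact ⟨hε.ne, fun hp => absurd hp hε.not_gt⟩
    · filter_upwards [self_mem_nhdsWithin] with ε hε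
      rw [heq, zero_add]
      exact ⟨mul_ne_zero (ne_of_gt hε) (hf ⟨α, hα⟩), fun _ => le_rfl⟩
    · filter_upwards [hlim.eventually_const_lt hgt] with ε hε
      exact ⟨hε.ne', fun _ => hgt.le⟩
  obtain ⟨ε, hε⟩ := ((Filter.eventually_all_finite h.finite).2 key).exists
  refine ⟨B v + ε • f, fun α hα => ?_⟩
  have h1 := hε α hα
  rw [h.symm] at h1
  rw [h.symm α v]
  exact h1

/-- Steinberg's theorem: the stabilizer of a vector in a finite real reflection group is generated
by the reflections in the roots orthogonal to that vector. -/
theorem mem_closure_of_fixed [FiniteDimensional ℝ U] (h : IsRootSystem B Φ) {v : U}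
    {g : U ≃ₗ[ℝ] U} (hg : g ∈ Subgroup.closure (rootReflection B '' Φ)) (hv : g v = v) :
    g ∈ Subgroup.closure (rootReflection B '' {α | α ∈ Φ ∧ B α v = 0}) := by
  obtain ⟨ht, hht⟩ := exists_dominating_height h v
  have hne : ∀ α ∈ Φ, ht α ≠ 0 := fun α hα => (hht α hα).1
  obtain ⟨Δ, hΔ⟩ := exists_isBase h.finite ht
  have hgΔ : g ∈ Subgroup.closure (rootReflection B '' (Δ : Set U)) := by
    refine (Subgroup.closure_le _).2 ?_ hg
    rintro _ ⟨α, hα, rfl⟩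
    rcases lt_or_gt_of_ne (hne α hα) with hlt | hgt
    · have h1 : rootReflection B α = rootReflection B (-α) := by
        ext x
        rw [rootReflection_apply (h.norm _ hα), rootReflection_apply (h.norm _ (h.neg_mem hα))]
        simp
      rw [h1]
      exact rootReflection_mem_closure_base h hne hΔ (h.neg_mem hα) (by simpa using hlt)
    · exact rootReflection_mem_closure_base h hne hΔ hα hgt
  obtain ⟨l, hl, rfl⟩ := exists_reflectionWord (fun δ hδ => h.norm δ (hΔ.subset δ hδ)) hgΔ
  clear hg hgΔ
  induction hn : l.length using Nat.strong_induction_on generalizing l with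
  | _ n IH =>
  rcases List.eq_nil_or_concat' l with rfl | ⟨l₀, δ, rfl⟩
  · exact one_mem _
  have hδ : δ ∈ Δ := hl δ (by simp)
  have hl₀ : ∀ γ ∈ l₀, γ ∈ Δ := fun γ hγ => hl γ (by simp [hγ])
  have hδΦ := hΔ.subset δ hδ
  have hl₀Φ : ∀ γ ∈ l₀, γ ∈ Φ := fun γ hγ => hΔ.subset γ (hl₀ γ hγ)
  have hw : reflectionWord B (l₀ ++ [δ]) = reflectionWord B l₀ * rootReflection B δ := by
    simp [reflectionWord]
  rw [List.length_append, List.length_singleton] at hn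
  rw [hw] at hv ⊢
  have hβ := reflectionWord_mem h hl₀Φ hδΦ
  rcases lt_or_gt_of_ne (hne _ hβ) with hlt | hgt
  · obtain ⟨l', hl', hlen, hw'⟩ := exists_shorter_word h hne hΔ hδ hl₀ hlt
    rw [hw'] at hv ⊢
    exact IH _ (by omega) l' hl' hv rfl
  -- As `v` is dominant, `B (l₀ δ) v ≥ 0`. Invariance and `l₀ s_δ v = v` identify this with `-B δ v
  -- ≤ 0`. So `δ` is orthogonal to `v`, and the last letter already fixes `v`.
  · have h1 : 0 ≤ B δ v := (hht δ hδΦ).2 (hΔ.pos δ hδ)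
    have h2 : 0 ≤ B (reflectionWord B l₀ δ) v := (hht _ hβ).2 hgt
    have h3 : B (reflectionWord B l₀ δ) v = -B δ v := by
      conv_lhs => rw [← hv]
      rw [LinearEquiv.mul_apply, reflectionWord_isometry h hl₀Φ,
        rootReflection_apply (h.norm δ hδΦ), map_sub, map_smul, h.norm δ hδΦ, smul_eq_mul]
      ring
    have h4 : B δ v = 0 := by linarith
    have h5 : rootReflection B δ v = v := by
      rw [rootReflection_apply (h.norm δ hδΦ), h4, zero_smul, sub_zero]
    rw [LinearEquiv.mul_apply, h5] at hv
    exact mul_mem (IH _ (by omega) l₀ hl₀ hv rfl)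
      (Subgroup.subset_closure ⟨δ, ⟨hδΦ, h4⟩, rfl⟩)

end RootSystems

end ReflQuot

namespace ReflQuot

/-! ### Invariant forms, roots of a real reflection group, and rank three. -/

section InvariantForms

variable {U : Type*} [AddCommGroup U] [Module ℝ U]

/-- A positive definite symmetric form that is invariant under a linear group. -/
structure IsInvariantForm (G : Subgroup (U ≃ₗ[ℝ] U)) (B : LinearMap.BilinForm ℝ U) : Prop where
  symm : ∀ x y, B x y = B y x
  pos : ∀ x, x ≠ 0 → 0 < B x x
  inv : ∀ g ∈ G, ∀ x y, B (g x) (g y) = B x y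

theorem exists_isInvariantForm [FiniteDimensional ℝ U] (G : Subgroup (U ≃ₗ[ℝ] U)) [Finite G] :
    ∃ B, IsInvariantForm G B := by
  cases nonempty_fintype G
  let b := Module.finBasis ℝ U
  let B₀ : LinearMap.BilinForm ℝ U := ∑ i, (LinearMap.mul ℝ ℝ).compl₁₂ (b.coord i) (b.coord i)
  have hB₀ : ∀ x y, B₀ x y = ∑ i, b.coord i x * b.coord i y := fun x y => by
    simp [B₀, LinearMap.sum_apply]
  have hpos₀ : ∀ x, x ≠ 0 → 0 < B₀ x x := fun x hx => by
    rw [hB₀]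
    obtain ⟨i, hi⟩ : ∃ i, b.coord i x ≠ 0 := by
      by_contra! h
      exact hx (b.ext_elem fun i => by simpa using h i)
    exact Finset.sum_pos' (fun i _ => mul_self_nonneg _)
      ⟨i, Finset.mem_univ _, mul_self_pos.2 hi⟩
  let B : LinearMap.BilinForm ℝ U := ∑ g : G,
    B₀.compl₁₂ ((g : U ≃ₗ[ℝ] U) : U →ₗ[ℝ] U) ((g : U ≃ₗ[ℝ] U) : U →ₗ[ℝ] U)
  have hB : ∀ x y, B x y = ∑ g : G, B₀ ((g : U ≃ₗ[ℝ] U) x) ((g : U ≃ₗ[ℝ] U) y) := fun x y => by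
    simp [B, LinearMap.sum_apply]
  refine ⟨B, fun x y => ?_, fun x hx => ?_, fun h hh x y => ?_⟩
  · simp only [hB, hB₀, mul_comm]
  · rw [hB]
    exact Finset.sum_pos (fun g _ => hpos₀ _ (by simpa using hx)) Finset.univ_nonempty
  · rw [hB, hB]
    exact Fintype.sum_equiv (Equiv.mulRight (⟨h, hh⟩ : G)) _ _ fun g => rfl

variable {G : Subgroup (U ≃ₗ[ℝ] U)} {B : LinearMap.BilinForm ℝ U}

theorem eq_or_eq_neg_of_rootReflection_eq {α β : U} (hα : B α α = 2) (hβ : B β β = 2)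
    (h : rootReflection B α = rootReflection B β) : α = β ∨ α = -β := by
  have h1 : rootReflection B β α = -α := by rw [← h, rootReflection_self hα]
  rw [rootReflection_apply hβ, sub_eq_iff_eq_add, neg_add_eq_sub, eq_sub_iff_add_eq,
    ← two_smul ℝ] at h1
  have h2 : α = (B β α / 2) • β := by
    rw [div_eq_inv_mul, mul_smul, ← h1, inv_smul_smul₀ two_ne_zero]
  set c := B β α / 2
  have h3 := hα
  rw [h2, map_smul, map_smul, LinearMap.smul_apply, hβ, smul_eq_mul, smul_eq_mul] at h3
  have h4 : c * c = 1 := by linarith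
  rcases mul_self_eq_one_iff.1 h4 with hc | hc
  · exact Or.inl (by rw [h2, hc, one_smul])
  · exact Or.inr (by rw [h2, hc, neg_one_smul])

/-- All the vectors of norm `2` whose reflections lie in `G`. -/
def rootsOf (G : Subgroup (U ≃ₗ[ℝ] U)) (B : LinearMap.BilinForm ℝ U) : Set U :=
  {α | B α α = 2 ∧ rootReflection B α ∈ G}

theorem IsInvariantForm.map_mem_rootsOf (hB : IsInvariantForm G B) {g : U ≃ₗ[ℝ] U} (hg : g ∈ G)
    {α : U} (hα : α ∈ rootsOf G B) : g α ∈ rootsOf G B := by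
  refine ⟨by rw [hB.inv g hg, hα.1], ?_⟩
  have h1 := conj_rootReflection (hB.inv g hg) hα.1
  rw [← mul_inv_eq_iff_eq_mul] at h1
  rw [← h1]
  exact mul_mem (mul_mem hg hα.2) (inv_mem hg)

theorem finite_rootsOf [Finite G] : (rootsOf G B).Finite := by
  refine Set.Finite.of_finite_fibers (rootReflection B) ?_ ?_
  · refine Set.Finite.subset (Set.toFinite (G : Set (U ≃ₗ[ℝ] U))) ?_
    rintro _ ⟨α, hα, rfl⟩
    exact hα.2
  · rintro _ ⟨α, hα, rfl⟩
    refine Set.Finite.subset (Set.toFinite {α, -α}) ?_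
    rintro β ⟨hβ, h⟩
    exact eq_or_eq_neg_of_rootReflection_eq hβ.1 hα.1 h

theorem IsInvariantForm.isRootSystem [Finite G] (hB : IsInvariantForm G B) :
    IsRootSystem B (rootsOf G B) where
  symm := hB.symm
  finite := finite_rootsOf
  norm _ hα := hα.1
  stable _ hα _ hβ := hB.map_mem_rootsOf hα.2 hβ

/-- An isometry fixing the orthogonal complement of a vector is trivial or a reflection. -/
theorem IsInvariantForm.eq_one_or_eq_rootReflection (hB : IsInvariantForm G B) {s : U ≃ₗ[ℝ] U}
    (hs : s ∈ G) {α : U} (hα : B α α = 2) (h : ∀ x, B α x = 0 → s x = x) :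
    s = 1 ∨ s = rootReflection B α := by
  have hdecomp : ∀ x, s x = x + (B α x / 2) • (s α - α) := fun x => by
    have h1 := h (x - (B α x / 2) • α) (by simp [hα])
    rw [map_sub, map_smul, sub_eq_iff_eq_add] at h1
    rw [h1, smul_sub]
    abel
  -- The component `y` of `s α` orthogonal to `α` is fixed by `s`. Hence it is orthogonal to `s α`
  -- as well, therefore to itself.
  have hy : s α = (B α (s α) / 2) • α := by
    by_contra hne
    set y := s α - (B α (s α) / 2) • α with hy
    have hαy : B α y = 0 := by
      rw [hy, map_sub, map_smul, hα, smul_eq_mul, div_mul_cancel₀ _ two_ne_zero, sub_self]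
    have h1 : B (s α) y = 0 := by
      rw [← h y hαy, hB.inv s hs, hαy]
    have h2 : B y y = 0 :=
      calc B y y = B (s α - (B α (s α) / 2) • α) y := by rw [← hy]
        _ = B (s α) y - (B α (s α) / 2) * B α y := by
          rw [LinearMap.map_sub B, LinearMap.map_smul B, LinearMap.sub_apply,
            LinearMap.smul_apply, smul_eq_mul]
        _ = 0 := by rw [h1, hαy, mul_zero, sub_zero]
    exact (hB.pos y (sub_ne_zero.2 hne)).ne' h2
  set c := B α (s α) / 2
  have hc := hB.inv s hs α α
  rw [hy, map_smul, map_smul, LinearMap.smul_apply, hα, smul_eq_mul, smul_eq_mul] at hc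
  have hc' : c * c = 1 := by linarith
  rcases mul_self_eq_one_iff.1 hc' with hc | hc
  · left
    ext x
    rw [hdecomp, hy, hc, one_smul, sub_self, smul_zero, add_zero]
    rfl
  · right
    ext x
    rw [hdecomp, hy, hc, rootReflection_apply hα, neg_one_smul, ← neg_add', smul_neg,
      ← two_smul ℝ, smul_smul, div_mul_cancel₀ _ two_ne_zero, sub_eq_add_neg]

variable [FiniteDimensional ℝ U]

theorem IsInvariantForm.exists_dual_eq (hB : IsInvariantForm G B) (φ : Module.Dual ℝ U) :
    ∃ α, B α = φ := by
  have hinj : Function.Injective B := by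
    rw [injective_iff_map_eq_zero]
    intro x hx
    by_contra h0
    exact (hB.pos x h0).ne' (by rw [hx]; rfl)
  have hsurj := (LinearMap.injective_iff_surjective_of_finrank_eq_finrank
    (f := (B : U →ₗ[ℝ] Module.Dual ℝ U)) Subspace.dual_finrank_eq.symm).1 hinj
  exact hsurj φ

/-- The form represents the functional of the mirror by a vector, which is rescaled to norm `2`; a
nontrivial isometry fixing its orthogonal complement is the orthogonal reflection. -/
theorem IsInvariantForm.exists_rootReflection_eq (hB : IsInvariantForm G B) {s : U ≃ₗ[ℝ] U}
    (hs : s ∈ G) (hr : IsReflection s) : ∃ α ∈ rootsOf G B, rootReflection B α = s := by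
  have hs1 : s ≠ 1 := by
    rintro rfl
    have h1 : ((1 : U ≃ₗ[ℝ] U) : U →ₗ[ℝ] U).fixedSubmodule = ⊤ := by
      refine eq_top_iff.2 fun x _ => ?_
      simp
    rw [IsReflection, h1, Module.finrank_zero_of_subsingleton] at hr
    exact zero_ne_one hr
  obtain ⟨φ, hφ⟩ := exists_dual_of_isReflection hr
  obtain ⟨α₀, rfl⟩ := hB.exists_dual_eq φ
  have hα₀ : α₀ ≠ 0 := by
    rintro rfl
    exact hs1 (LinearEquiv.ext fun x => hφ x (by simp))
  have hpos := hB.pos α₀ hα₀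
  set r := √(2 / B α₀ α₀)
  have hr0 : r ≠ 0 := (Real.sqrt_pos.2 (by positivity)).ne'
  have hrr : r * r = 2 / B α₀ α₀ := Real.mul_self_sqrt (by positivity)
  have hα : B (r • α₀) (r • α₀) = 2 := by
    rw [map_smul, map_smul, LinearMap.smul_apply, smul_eq_mul, smul_eq_mul, ← mul_assoc, hrr,
      div_mul_cancel₀ _ hpos.ne']
  have h1 := (hB.eq_one_or_eq_rootReflection hs hα fun x hx => hφ x (by
    rw [map_smul, LinearMap.smul_apply, smul_eq_mul] at hx
    exact (mul_eq_zero.1 hx).resolve_left hr0)).resolve_left hs1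
  exact ⟨r • α₀, ⟨hα, h1 ▸ hs⟩, h1.symm⟩

theorem IsInvariantForm.le_closure_rootsOf (hB : IsInvariantForm G B) (hG : IsReflectionGroup G) :
    G ≤ Subgroup.closure (rootReflection B '' rootsOf G B) := by
  conv_lhs => rw [← hG.2]
  refine Subgroup.closure_mono ?_
  rintro s ⟨hs, hr⟩
  exact hB.exists_rootReflection_eq hs hr

/-- The centralizer of a reflection acts on its mirror through a group generated by reflections. -/
theorem generatedOnFixed_of_isReflection (hG : IsReflectionGroup G) {g : U ≃ₗ[ℝ] U} (hg : g ∈ G)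
    (hr : IsReflection g) : GeneratedOnFixed G g := by
  have := hG.1
  obtain ⟨B, hB⟩ := exists_isInvariantForm G
  obtain ⟨α, hα, rfl⟩ := hB.exists_rootReflection_eq hg hr
  have key : ∀ k ∈ G, k α = α → k ∈ Subgroup.closure {t : U ≃ₗ[ℝ] U | t ∈ G ∧
      t * rootReflection B α = rootReflection B α * t ∧ ∃ φ : Module.Dual ℝ U,
        ∀ x, rootReflection B α x = x → φ x = 0 → t x = x} := by
    intro k hk hkα
    refine Subgroup.closure_mono ?_
      (mem_closure_of_fixed hB.isRootSystem (hB.le_closure_rootsOf hG hk) hkα)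
    rintro _ ⟨β, ⟨hβ, hβα⟩, rfl⟩
    have h1 := conj_rootReflection (hB.inv _ hβ.2) hα.1
    rw [rootReflection_apply hβ.1 α, hβα, zero_smul, sub_zero] at h1
    refine ⟨hβ.2, h1, B β, fun x _ hx => ?_⟩
    rw [rootReflection_apply hβ.1, hx, zero_smul, sub_zero]
  intro h hh hcomm
  have hhα : rootReflection B (h α) = rootReflection B α := by
    rw [conj_rootReflection (hB.inv h hh) hα.1] at hcomm
    exact mul_right_cancel hcomm
  rcases eq_or_eq_neg_of_rootReflection_eq (hB.map_mem_rootsOf hh hα).1 hα.1 hhα with h1 | h1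
  · exact ⟨h, key h hh h1, fun _ _ => rfl⟩
  -- Composing with the reflection itself corrects the sign of `h α` and changes nothing on the
  -- mirror.
  · refine ⟨rootReflection B α * h, key _ (mul_mem hg hh) ?_, fun x hx => ?_⟩
    · rw [LinearEquiv.mul_apply, h1, map_neg, rootReflection_self hα.1, neg_neg]
    · rw [← hcomm, LinearEquiv.mul_apply, hx]

theorem isReflection_of_finrank {g : U ≃ₗ[ℝ] U}
    (h : Module.finrank ℝ (g : U →ₗ[ℝ] U).fixedSubmodule + 1 = Module.finrank ℝ U) :
    IsReflection g := by
  have h1 := Submodule.finrank_quotient_add_finrank (g : U →ₗ[ℝ] U).fixedSubmodule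
  rw [IsReflection]
  omega

/-- An element that is neither trivial nor a reflection has fixed space of codimension at least two,
hence at most one dimension above the invariants. -/
theorem generatedOnFixed_of_rank_le_three (hG : IsReflectionGroup G) (hr : rank G ≤ 3)
    {g : U ≃ₗ[ℝ] U} (hg : g ∈ G) : GeneratedOnFixed G g := by
  by_cases h1 : g = 1
  · rw [h1]
    exact generatedOnFixed_one hG
  have h2 := finrank_fixed_lt h1
  by_cases h3 : Module.finrank ℝ (g : U →ₗ[ℝ] U).fixedSubmodule + 1 = Module.finrank ℝ U
  · exact generatedOnFixed_of_isReflection hG hg (isReflection_of_finrank h3)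
  · have h4 := finrank_fixedBy_add_rank G
    exact generatedOnFixed_of_finrank_le hg (by omega)

end InvariantForms

end ReflQuot

namespace ReflQuot

/-! ### The root system of type `H₄` in exact arithmetic over `ℤ[φ]`. -/

section GoldenVectors

/-- Quadruples of elements `a + b * φ` of `ℤ[φ]`, written as pairs `(a, b)`: the coordinates of a
vector with respect to the simple roots of type `H₄`. -/
abbrev GoldenVector := (ℤ × ℤ) × (ℤ × ℤ) × (ℤ × ℤ) × (ℤ × ℤ)

/-- Multiplication in `ℤ[φ]`. -/
def goldenMul (p q : ℤ × ℤ) : ℤ × ℤ :=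
  (p.1 * q.1 + p.2 * q.2, p.1 * q.2 + p.2 * q.1 + p.2 * q.2)

/-- Multiplication by `φ` in `ℤ[φ]`. -/
def goldenShift (p : ℤ × ℤ) : ℤ × ℤ := (p.2, p.1 + p.2)

/-- The simple coroots of type `H₄`. -/
def goldenCoroot (i : Fin 4) (r : GoldenVector) : ℤ × ℤ :=
  match i with
  | 0 => r.1 + r.1 - r.2.1
  | 1 => r.2.1 + r.2.1 - r.1 - r.2.2.1
  | 2 => r.2.2.1 + r.2.2.1 - r.2.1 - goldenShift r.2.2.2
  | 3 => r.2.2.2 + r.2.2.2 - goldenShift r.2.2.1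

/-- The simple reflections of type `H₄`. -/
def goldenReflect (i : Fin 4) (r : GoldenVector) : GoldenVector :=
  match i with
  | 0 => (r.1 - goldenCoroot 0 r, r.2.1, r.2.2.1, r.2.2.2)
  | 1 => (r.1, r.2.1 - goldenCoroot 1 r, r.2.2.1, r.2.2.2)
  | 2 => (r.1, r.2.1, r.2.2.1 - goldenCoroot 2 r, r.2.2.2)
  | 3 => (r.1, r.2.1, r.2.2.1, r.2.2.2 - goldenCoroot 3 r)

/-- The invariant form of type `H₄`. -/
def goldenForm (r s : GoldenVector) : ℤ × ℤ :=
  goldenMul r.1 (goldenCoroot 0 s) + goldenMul r.2.1 (goldenCoroot 1 s) +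
    goldenMul r.2.2.1 (goldenCoroot 2 s) + goldenMul r.2.2.2 (goldenCoroot 3 s)

/-- The first simple root. -/
def goldenSimple : GoldenVector := ((1, 0), (0, 0), (0, 0), (0, 0))

/-- The positive roots of type `H₄`. -/
def goldenRoots : List GoldenVector :=
  [
    ((1, 0), (0, 0), (0, 0), (0, 0)), ((1, 0), (1, 0), (0, 0), (0, 0)),
    ((0, 0), (1, 0), (0, 0), (0, 0)), ((1, 0), (1, 0), (1, 0), (0, 0)),
    ((0, 0), (1, 0), (1, 0), (0, 0)), ((1, 0), (1, 0), (1, 0), (0, 1)),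
    ((0, 0), (0, 0), (1, 0), (0, 0)), ((0, 0), (1, 0), (1, 0), (0, 1)),
    ((1, 0), (1, 0), (1, 1), (0, 1)), ((0, 0), (0, 0), (1, 0), (0, 1)),
    ((0, 0), (1, 0), (1, 1), (0, 1)), ((1, 0), (1, 1), (1, 1), (0, 1)),
    ((1, 0), (1, 0), (1, 1), (1, 1)), ((0, 0), (0, 0), (0, 1), (0, 1)),
    ((0, 0), (0, 1), (1, 1), (0, 1)), ((0, 0), (1, 0), (1, 1), (1, 1)),
    ((0, 1), (1, 1), (1, 1), (0, 1)), ((1, 0), (1, 1), (1, 1), (1, 1)),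
    ((0, 0), (0, 1), (0, 1), (0, 1)), ((0, 0), (0, 0), (0, 1), (1, 0)),
    ((0, 1), (0, 1), (1, 1), (0, 1)), ((0, 0), (0, 1), (1, 1), (1, 1)),
    ((0, 1), (1, 1), (1, 1), (1, 1)), ((1, 0), (1, 1), (1, 2), (1, 1)),
    ((0, 1), (0, 1), (0, 1), (0, 1)), ((0, 0), (0, 1), (0, 1), (1, 0)),
    ((0, 0), (0, 0), (0, 0), (1, 0)), ((0, 1), (0, 1), (1, 1), (1, 1)),
    ((0, 0), (0, 1), (0, 2), (1, 1)), ((0, 1), (1, 1), (1, 2), (1, 1)),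
    ((1, 0), (1, 1), (1, 2), (1, 2)), ((0, 1), (0, 1), (0, 1), (1, 0)),
    ((0, 1), (0, 1), (0, 2), (1, 1)), ((0, 1), (0, 2), (1, 2), (1, 1)),
    ((0, 1), (1, 1), (1, 2), (1, 2)), ((1, 0), (1, 1), (2, 2), (1, 2)),
    ((0, 1), (0, 2), (0, 2), (1, 1)), ((0, 1), (0, 2), (1, 2), (1, 2)),
    ((0, 1), (1, 1), (2, 2), (1, 2)), ((1, 0), (2, 1), (2, 2), (1, 2)),
    ((0, 1), (0, 2), (1, 3), (1, 2)), ((0, 1), (1, 2), (2, 2), (1, 2)),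
    ((1, 1), (2, 1), (2, 2), (1, 2)), ((0, 1), (1, 2), (1, 3), (1, 2)),
    ((0, 1), (0, 2), (1, 3), (2, 2)), ((1, 1), (1, 2), (2, 2), (1, 2)),
    ((1, 1), (1, 2), (1, 3), (1, 2)), ((0, 1), (1, 2), (1, 3), (2, 2)),
    ((1, 1), (1, 2), (1, 3), (2, 2)), ((0, 1), (1, 2), (2, 3), (2, 2)),
    ((1, 1), (1, 2), (2, 3), (2, 2)), ((0, 1), (1, 2), (2, 3), (1, 3)),
    ((1, 1), (2, 2), (2, 3), (2, 2)), ((1, 1), (1, 2), (2, 3), (1, 3)),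
    ((1, 1), (2, 2), (2, 3), (1, 3)), ((1, 1), (2, 2), (3, 3), (1, 3)),
    ((1, 1), (2, 2), (3, 3), (2, 3)), ((1, 1), (2, 2), (2, 4), (2, 3)),
    ((1, 1), (1, 3), (2, 4), (2, 3)), ((0, 2), (1, 3), (2, 4), (2, 3))]

/-- Words in the simple reflections that carry the first simple root to roots orthogonal to it. -/
def goldenWords : List (List (Fin 4)) :=
  [[1, 2, 0, 1], [3, 1, 2, 0, 1], [2, 3, 1, 2, 0, 1], [3, 2, 3, 1, 2, 0, 1], [2, 3, 2, 3, 1, 2, 0, 1], [1, 2, 3, 0, 1, 2, 3, 2, 1], [1, 2, 3, 0, 1, 2, 3, 2, 0, 1], [3, 1, 2, 3, 0, 1, 2, 3, 2, 1], [2, 3, 1, 2, 3, 0, 1, 2, 3, 2, 1], [3, 2, 3, 1, 2, 3, 0, 1, 2, 3, 2, 1]]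

/-- The root obtained from the first simple root by a word in the simple reflections. -/
def goldenWordRoot (w : List (Fin 4)) : GoldenVector := w.foldr goldenReflect goldenSimple

/-- Makes the list, up to sign, contain the whole orbit of the first simple root. -/
theorem goldenReflect_mem : ∀ r ∈ goldenRoots, ∀ i,
    goldenReflect i r ∈ goldenRoots ∨ -goldenReflect i r ∈ goldenRoots := by
  decide +kernel

/-- The orbit is transitive, so one of two given roots can be moved to the first simple root; this
settles all positions of the other. Giving the orthogonal root by a word certifies that it lies in
the orbit. -/
theorem exists_goldenWord_orthogonal : ∀ r ∈ goldenRoots, ∃ w ∈ goldenWords,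
    goldenCoroot 0 (goldenWordRoot w) = 0 ∧ goldenForm r (goldenWordRoot w) = 0 := by
  decide +kernel

end GoldenVectors

end ReflQuot

namespace ReflQuot

/-! ### Fixed spaces of codimension two and isometries of a plane. -/

section PlaneSections

variable {U : Type*} [AddCommGroup U] [Module ℝ U] {G : Subgroup (U ≃ₗ[ℝ] U)}
  {B : LinearMap.BilinForm ℝ U}

theorem mem_orthogonal_fixedBy (hB : IsInvariantForm G B) {γ : U} (hγ : γ ∈ rootsOf G B) {n : U}
    (hn : n ∈ fixedBy G) : B n γ = 0 := by
  have h1 := mem_fixedBy.1 hn _ hγ.2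
  rw [rootReflection_apply hγ.1, sub_eq_self] at h1
  rw [hB.symm]
  refine (smul_eq_zero.1 h1).resolve_right fun h => ?_
  have h2 := hγ.1
  rw [h] at h2
  simp at h2

theorem eq_of_mem_closure_rootReflection {Ψ : Set U} (hΨ : ∀ α ∈ Ψ, B α α = 2) {x : U}
    (hx : ∀ α ∈ Ψ, B α x = 0) {g : U ≃ₗ[ℝ] U}
    (hg : g ∈ Subgroup.closure (rootReflection B '' Ψ)) : g x = x := by
  induction hg using Subgroup.closure_induction with
  | mem s hs =>
    obtain ⟨α, hα, rfl⟩ := hs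
    rw [rootReflection_apply (hΨ α hα), hx α hα, zero_smul, sub_zero]
  | one => rfl
  | mul g k _ _ hg hk => rw [LinearEquiv.mul_apply, hk, hg]
  | inv g _ hg =>
    conv_lhs => rw [← hg]
    exact g.symm_apply_apply x

/-- In a plane, an isometry moves a vector `γ` in such a way that `γ`, `h γ` are dependent or span
the plane; in both cases `h` or `h` composed with the reflection in `γ` fixes a vector. -/
theorem exists_fixed_vector {s h : U ≃ₗ[ℝ] U} {γ : U} (hB : IsInvariantForm G B) (hh : h ∈ G)
    (hγ : B γ γ = 2) (hs : s = rootReflection B γ) {a b : ℝ}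
    (hlin : h (h γ) = a • γ + b • h γ) (hne : h γ ≠ γ) (hne' : h γ ≠ -γ) :
    h (γ + h γ) = γ + h γ ∨ (h * s) (γ - h γ) = γ - h γ := by
  set c := B γ (h γ) with hc
  have hinv := hB.inv h hh
  have h1 : c = a * c + b * 2 := by
    have h2 := hinv γ (h γ)
    rw [hlin] at h2
    simp only [map_add, map_smul, smul_eq_mul, hinv, hγ, hB.symm (h γ) γ, ← hc] at h2
    linarith
  have h2 : 2 = a * a * 2 + 2 * (a * b * c) + b * b * 2 := by
    have h3 := hinv (h γ) (h γ)
    rw [hlin] at h3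
    simp only [map_add, map_smul, smul_eq_mul, hinv, hγ, hB.symm (h γ) γ, ← hc,
      LinearMap.add_apply, LinearMap.smul_apply] at h3
    linarith
  have hc1 : c ≠ 2 := fun h0 => by
    refine (hB.pos _ (sub_ne_zero.2 hne)).ne' ?_
    simp only [map_sub, LinearMap.sub_apply, hinv, hγ, hB.symm (h γ) γ, ← hc, h0]
    norm_num
  have hc2 : c ≠ -2 := fun h0 => by
    refine (hB.pos (h γ + γ) fun h3 => hne' (eq_neg_of_add_eq_zero_left h3)).ne' ?_
    simp only [map_add, LinearMap.add_apply, hinv, hγ, hB.symm (h γ) γ, ← hc, h0]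
    norm_num
  have hb : b = c * (1 - a) / 2 := by linarith
  -- By Cayley–Hamilton on the plane of `γ` and `h γ`, `a` is minus the determinant and `b` the
  -- trace. If `a = 1`, `h` is a reflection swapping `γ` and `h γ`; if `a = -1`, `h` is a rotation
  -- and `h * s` swaps `γ` and `-h γ`.
  have h3 : (1 - a) * ((1 + a) * ((2 - c) * (2 + c))) = 0 := by
    rw [hb] at h2
    nlinarith
  have hcc : (2 - c) * (2 + c) ≠ 0 :=
    mul_ne_zero (sub_ne_zero.2 hc1.symm) fun h0 => hc2 (by linarith)
  rcases mul_eq_zero.1 h3 with h4 | h4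
  · left
    have ha : a = 1 := by linarith
    rw [ha, sub_self, mul_zero, zero_div] at hb
    rw [map_add, hlin, ha, hb, one_smul, zero_smul, add_zero, add_comm]
  · right
    have ha : a = -1 := by linarith [(mul_eq_zero.1 h4).resolve_right hcc]
    have hb' : b = c := by rw [hb, ha]; ring
    rw [LinearEquiv.mul_apply, map_sub, hs, rootReflection_self hγ, rootReflection_apply hγ,
      ← hc, map_sub, map_sub, map_smul, hlin, ha, hb', map_neg, neg_one_smul]
    abel

variable [FiniteDimensional ℝ U]

/-- One fixed vector of `V^g` outside `V^G` already brings the fixed part of `V^g` to codimension at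
most one. -/
theorem exists_dual_of_fixed {g t : U ≃ₗ[ℝ] U} (hg : g ∈ G) (ht : t ∈ G)
    (hdim : Module.finrank ℝ (g : U →ₗ[ℝ] U).fixedSubmodule ≤
      Module.finrank ℝ (fixedBy G) + 2)
    {x : U} (hgx : g x = x) (htx : t x = x) (hx : x ∉ fixedBy G) :
    ∃ φ : Module.Dual ℝ U, ∀ y, g y = y → φ y = 0 → t y = y := by
  have hlt : fixedBy G <
      (g : U →ₗ[ℝ] U).fixedSubmodule ⊓ (t : U →ₗ[ℝ] U).fixedSubmodule := by
    refine lt_of_le_of_ne (le_inf (fixedBy_le hg) (fixedBy_le ht)) fun h => hx ?_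
    rw [h]
    exact ⟨LinearMap.mem_fixedSubmodule_iff.2 hgx, LinearMap.mem_fixedSubmodule_iff.2 htx⟩
  have h1 := Submodule.finrank_lt_finrank_of_lt hlt
  obtain ⟨φ, hφ⟩ := exists_dual_of_finrank_le (inf_le_left (a := (g : U →ₗ[ℝ] U).fixedSubmodule)
    (b := (t : U →ₗ[ℝ] U).fixedSubmodule)) (by omega)
  exact ⟨φ, fun y hy h0 => LinearMap.mem_fixedSubmodule_iff.1
    (hφ y (LinearMap.mem_fixedSubmodule_iff.2 hy) h0).2⟩

/-- If a root lies in the fixed space of `g`, and that space has dimension at most two modulo the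
invariants of `G`, then the centralizer of `g` acts on it through a group generated by
reflections. -/
theorem generatedOnFixed_of_root (hB : IsInvariantForm G B) {g : U ≃ₗ[ℝ] U} (hg : g ∈ G)
    (hdim : Module.finrank ℝ (g : U →ₗ[ℝ] U).fixedSubmodule ≤
      Module.finrank ℝ (fixedBy G) + 2)
    {γ : U} (hγ : γ ∈ rootsOf G B) (hgγ : g γ = γ) : GeneratedOnFixed G g := by
  set s := rootReflection B γ with hs
  have hsg : s * g = g * s := by
    have h1 := conj_rootReflection (hB.inv g hg) hγ.1
    rw [hgγ] at h1
    exact h1.symm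
  let T := {t : U ≃ₗ[ℝ] U | t ∈ G ∧ t * g = g * t ∧
    ∃ φ : Module.Dual ℝ U, ∀ x, g x = x → φ x = 0 → t x = x}
  have hsT : s ∈ T := ⟨hγ.2, hsg, B γ, fun x _ hx => by
    rw [hs, rootReflection_apply hγ.1, hx, zero_smul, sub_zero]⟩
  have hγN : γ ∉ fixedBy G := fun h0 => two_ne_zero (hγ.1 ▸ mem_orthogonal_fixedBy hB hγ h0)
  intro h hh hcomm
  have hcomm' : h * s * g = g * (h * s) := by rw [mul_assoc, hsg, ← mul_assoc, hcomm, mul_assoc]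
  -- It suffices that `h` or `h * s` fixes a new vector of `V^g`, since `h = (h * s) * s`.
  have key : ∀ x, g x = x → x ∉ fixedBy G → (h x = x ∨ (h * s) x = x) →
      ∃ k ∈ Subgroup.closure T, ∀ x, g x = x → h x = k x := by
    rintro x hgx hx (hhx | hhx)
    · exact ⟨h, Subgroup.subset_closure
        ⟨hh, hcomm, exists_dual_of_fixed hg hh hdim hgx hhx hx⟩, fun _ _ => rfl⟩
    · have h1 : h * s ∈ T := ⟨mul_mem hh hγ.2, hcomm',
        exists_dual_of_fixed hg (mul_mem hh hγ.2) hdim hgx hhx hx⟩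
      refine ⟨h * s * s, mul_mem (Subgroup.subset_closure h1) (Subgroup.subset_closure hsT),
        fun _ _ => ?_⟩
      rw [mul_assoc, hs, rootReflection_mul_self hγ.1, mul_one]
  by_cases hne : h γ = γ
  · exact key γ hgγ hγN (Or.inl hne)
  by_cases hne' : h γ = -γ
  · refine key γ hgγ hγN (Or.inr ?_)
    rw [LinearEquiv.mul_apply, hs, rootReflection_self hγ.1, map_neg, hne', neg_neg]
  have hfix : ∀ x, g x = x → g (h x) = h x := fun x hx => by
    have h1 := DFunLike.congr_fun hcomm x
    rw [LinearEquiv.mul_apply, LinearEquiv.mul_apply, hx] at h1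
    exact h1.symm
  have hortho : ∀ n ∈ fixedBy G, ∀ x, B n x = 0 → B n (h x) = 0 := fun n hn x hx => by
    conv_lhs => rw [← mem_fixedBy.1 hn h hh]
    rw [hB.inv h hh, hx]
  have hγo : ∀ n ∈ fixedBy G, B n γ = 0 := fun n hn => mem_orthogonal_fixedBy hB hγ hn
  let F := (g : U →ₗ[ℝ] U).fixedSubmodule
  -- The part of `V^g` orthogonal to the invariants: an `h`-stable space of dimension at most two
  -- that contains `γ`.
  let D := F ⊓ LinearMap.BilinForm.orthogonal B (fixedBy G)
  have hD : ∀ x, x ∈ D ↔ g x = x ∧ ∀ n ∈ fixedBy G, B n x = 0 := fun x => by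
    simp only [D, F, Submodule.mem_inf, LinearMap.mem_fixedSubmodule_iff,
      LinearMap.BilinForm.mem_orthogonal_iff]
    rfl
  have hDN : D ⊓ fixedBy G = ⊥ := by
    refine (Submodule.eq_bot_iff _).2 fun x hx => ?_
    by_contra h0
    exact (hB.pos x h0).ne' (((hD x).1 hx.1).2 x hx.2)
  have hDdim : Module.finrank ℝ D ≤ 2 := by
    have h1 := Submodule.finrank_sup_add_finrank_inf_eq D (fixedBy G)
    have h2 : Module.finrank ℝ (D ⊔ fixedBy G : Submodule ℝ U) ≤
        Module.finrank ℝ (g : U →ₗ[ℝ] U).fixedSubmodule :=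
      Submodule.finrank_mono (sup_le (inf_le_left : D ≤ F) (fixedBy_le hg))
    rw [hDN, finrank_bot] at h1
    omega
  have hγD : γ ∈ D := (hD γ).2 ⟨hgγ, hγo⟩
  have hhD : ∀ x ∈ D, h x ∈ D := fun x hx => (hD _).2
    ⟨hfix x ((hD x).1 hx).1, fun n hn => hortho n hn x (((hD x).1 hx).2 n hn)⟩
  have hind : LinearIndependent ℝ ![γ, h γ] := by
    rw [LinearIndependent.pair_iff' (show γ ≠ 0 from fun h0 => hγN (h0 ▸ Submodule.zero_mem _))]
    intro c hc
    have h1 := hB.inv h hh γ γ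
    rw [← hc, map_smul, map_smul, LinearMap.smul_apply, hγ.1, smul_eq_mul, smul_eq_mul] at h1
    rcases mul_self_eq_one_iff.1 (show c * c = 1 by linarith) with h2 | h2
    · exact hne (by rw [← hc, h2, one_smul])
    · exact hne' (by rw [← hc, h2, neg_one_smul])
  have hspan : Submodule.span ℝ {γ, h γ} = D := by
    have h1 := finrank_span_eq_card hind
    rw [Matrix.range_cons_cons_empty, Fintype.card_fin] at h1
    refine Submodule.eq_of_le_of_finrank_le (Submodule.span_le.2 ?_) (by rw [h1]; exact hDdim)
    rintro x (rfl | rfl)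
    exacts [hγD, hhD _ hγD]
  have hmem : h (h γ) ∈ Submodule.span ℝ {γ, h γ} := hspan ▸ hhD _ (hhD _ hγD)
  obtain ⟨a, b, hab⟩ := Submodule.mem_span_pair.1 hmem
  have hnot : ∀ x ∈ D, x ≠ 0 → x ∉ fixedBy G := fun x hx hx0 hxN =>
    hx0 ((Submodule.mem_bot ℝ).1 (hDN ▸ (⟨hx, hxN⟩ : x ∈ D ⊓ fixedBy G)))
  rcases exists_fixed_vector hB hh hγ.1 hs hab.symm hne hne' with h1 | h1
  · have hx := D.add_mem hγD (hhD γ hγD)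
    exact key _ ((hD _).1 hx).1
      (hnot _ hx fun h0 => hne' (eq_neg_of_add_eq_zero_right h0)) (Or.inl h1)
  · have hx := D.sub_mem hγD (hhD γ hγD)
    exact key _ ((hD _).1 hx).1 (hnot _ hx fun h0 => hne (sub_eq_zero.1 h0).symm) (Or.inr h1)

/-- If any two roots of a generating root system have a common orthogonal root, then an element
whose fixed space has codimension two fixes a root. -/
theorem exists_fixed_root {Φ : Set U} (hΦ : IsRootSystem B Φ)
    (hG : G ≤ Subgroup.closure (rootReflection B '' Φ))
    (hortho : ∀ α ∈ Φ, ∀ β ∈ Φ, ∃ γ ∈ Φ, B α γ = 0 ∧ B β γ = 0) {g : U ≃ₗ[ℝ] U} (hg : g ∈ G)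
    (hdim : Module.finrank ℝ (g : U →ₗ[ℝ] U).fixedSubmodule + 2 = Module.finrank ℝ U) :
    ∃ γ ∈ Φ, g γ = γ := by
  set F := (g : U →ₗ[ℝ] U).fixedSubmodule
  let Ψ := {α | α ∈ Φ ∧ ∀ x ∈ F, B α x = 0}
  -- Steinberg's theorem is applied to a generic `v ∈ F`: the only roots orthogonal to `v` are those
  -- orthogonal to all of `F`.
  have hgΨ : g ∈ Subgroup.closure (rootReflection B '' Ψ) := by
    have : Finite {α | α ∈ Φ ∧ ∃ x ∈ F, B α x ≠ 0} := hΦ.finite.subset fun α hα => hα.1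
    obtain ⟨v, hv, hvne⟩ := Module.Dual.exists_forall_mem_ne_zero_of_forall_exists F
      (fun α : {α | α ∈ Φ ∧ ∃ x ∈ F, B α x ≠ 0} => B α) fun α => α.2.2
    refine Subgroup.closure_mono ?_
      (mem_closure_of_fixed hΦ (hG hg) (LinearMap.mem_fixedSubmodule_iff.1 hv))
    rintro _ ⟨α, ⟨hα, hαv⟩, rfl⟩
    refine ⟨α, ⟨hα, ?_⟩, rfl⟩
    by_contra! hex
    exact hvne ⟨α, hα, hex⟩ hαv
  have hfixed : ∀ x, (∀ α ∈ Ψ, B α x = 0) → x ∈ F := by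
    intro x hx
    exact LinearMap.mem_fixedSubmodule_iff.2
      (eq_of_mem_closure_rootReflection (fun α hα => hΦ.norm α hα.1) hx hgΨ)
  have hker : ∀ α ∈ Φ, Module.finrank ℝ (LinearMap.ker (B α)) + 1 = Module.finrank ℝ U := by
    intro α hα
    refine Module.Dual.finrank_ker_add_one_of_ne_zero fun h0 => ?_
    have h1 := hΦ.norm α hα
    rw [h0] at h1
    simp at h1
  obtain ⟨α, hα⟩ : Ψ.Nonempty := by
    by_contra! hΨ
    have h1 : F = ⊤ := eq_top_iff.2 fun x _ => hfixed x (by simp [hΨ])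
    rw [h1, finrank_top] at hdim
    omega
  -- If every root of `Ψ` vanished on the hyperplane of `α`, that hyperplane would lie in `F`,
  -- contradicting codimension two. Two such roots cut out `F` exactly.
  obtain ⟨β, hβ, hαβ⟩ : ∃ β ∈ Ψ, ∃ x, B α x = 0 ∧ B β x ≠ 0 := by
    by_contra! hcon
    have h1 := Submodule.finrank_mono
      (fun x hx => hfixed x fun β hβ => hcon β hβ x hx : LinearMap.ker (B α) ≤ F)
    have h2 := hker α hα.1
    omega
  obtain ⟨γ, hγ, hαγ, hβγ⟩ := hortho α hα.1 β hβ.1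
  have hle : F ≤ LinearMap.ker (B α) ⊓ LinearMap.ker (B β) :=
    fun x hx => ⟨hα.2 x hx, hβ.2 x hx⟩
  have hlt : LinearMap.ker (B α) ⊓ LinearMap.ker (B β) < LinearMap.ker (B α) := by
    refine lt_of_le_of_ne inf_le_left fun h => ?_
    obtain ⟨x, hx, hx'⟩ := hαβ
    have h1 : x ∈ LinearMap.ker (B α) ⊓ LinearMap.ker (B β) := h.symm ▸ hx
    exact hx' h1.2
  have h1 := Submodule.finrank_lt_finrank_of_lt hlt
  have h2 := hker α hα.1
  have h3 := Submodule.eq_of_le_of_finrank_le hle (by omega)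
  refine ⟨γ, hγ, LinearMap.mem_fixedSubmodule_iff.1 (?_ : γ ∈ F)⟩
  rw [h3]
  exact ⟨hαγ, hβγ⟩

end PlaneSections

end ReflQuot

namespace ReflQuot

/-! ### Groups of type `H₄`. -/

section TypeH4

variable {U : Type*} [AddCommGroup U] [Module ℝ U] {G : Subgroup (U ≃ₗ[ℝ] U)}
  {B : LinearMap.BilinForm ℝ U}

theorem h4_gram : ∀ i j, -2 * Real.cos (Real.pi / (CoxeterMatrix.H₄ i j : ℝ)) =
    !![2, -1, 0, 0; -1, 2, -1, 0; 0, -1, 2, -Real.goldenRatio;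
      0, 0, -Real.goldenRatio, 2] i j := by
  have h1 : -2 * Real.cos (Real.pi / ((1 : ℕ) : ℝ)) = 2 := by simp
  have h2 : -2 * Real.cos (Real.pi / ((2 : ℕ) : ℝ)) = 0 := by simp
  have h3 : -2 * Real.cos (Real.pi / ((3 : ℕ) : ℝ)) = -1 := by
    simp
  have h5 : -2 * Real.cos (Real.pi / ((5 : ℕ) : ℝ)) = -Real.goldenRatio := by
    rw [Nat.cast_ofNat, Real.cos_pi_div_five, Real.goldenRatio]
    ring
  intro i j
  fin_cases i <;> fin_cases j <;> first | exact h1 | exact h2 | exact h3 | exact h5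

/-- An invariant form can be rescaled so that it induces the given simple coroots of type `H₄`. -/
theorem exists_form_of_typeH4 (hB : IsInvariantForm G B) {α : Fin 4 → U}
    {f : Fin 4 → Module.Dual ℝ U}
    (hgram : ∀ i j, f i (α j) = -2 * Real.cos (Real.pi / (CoxeterMatrix.H₄ i j : ℝ)))
    (hmem : ∀ i, ∃ s ∈ G, ∀ x, s x = x - f i x • α i) :
    ∃ B', IsInvariantForm G B' ∧ ∀ i, B' (α i) = f i := by
  simp only [h4_gram] at hgram
  have hself : ∀ i, f i (α i) = 2 := fun i => by
    rw [hgram]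
    fin_cases i <;> rfl
  have hcoroot : ∀ i x, f i x * B (α i) (α i) = 2 * B (α i) x := fun i x => by
    obtain ⟨s, hs, hsx⟩ := hmem i
    have h1 := hB.inv s hs (α i) x
    have h2 : s (α i) = -α i := by
      rw [hsx, hself, two_smul]
      abel
    rw [h2, hsx, map_neg, LinearMap.neg_apply, map_sub, map_smul, smul_eq_mul] at h1
    linarith
  -- Simple roots joined in the diagram have equal length. The diagram is connected, so one scaling
  -- normalizes all four.
  have hadj : ∀ i j, f i (α j) = f j (α i) → f i (α j) ≠ 0 →
      B (α i) (α i) = B (α j) (α j) := fun i j h hne => by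
    have h1 := hcoroot i (α j)
    have h2 := hcoroot j (α i)
    rw [hB.symm (α j) (α i), ← h1, ← h] at h2
    exact (mul_left_cancel₀ hne h2).symm
  have h01 : B (α 0) (α 0) = B (α 1) (α 1) := hadj 0 1 (by simp [hgram]) (by simp [hgram])
  have h12 : B (α 1) (α 1) = B (α 2) (α 2) := hadj 1 2 (by simp [hgram]) (by simp [hgram])
  have h23 : B (α 2) (α 2) = B (α 3) (α 3) :=
    hadj 2 3 (by simp [hgram]) (by
      rw [hgram]
      exact neg_ne_zero.2 Real.goldenRatio_ne_zero)
  have hq : ∀ i, B (α i) (α i) = B (α 0) (α 0) := by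
    intro i
    fin_cases i
    exacts [rfl, h01.symm, (h01.trans h12).symm, (h01.trans (h12.trans h23)).symm]
  have hpos : 0 < B (α 0) (α 0) := hB.pos _ fun h0 => by
    have h1 := hself 0
    rw [h0, map_zero] at h1
    exact two_ne_zero h1.symm
  refine ⟨(2 / B (α 0) (α 0)) • B, ⟨fun x y => ?_, fun x hx => ?_, fun g hg x y => ?_⟩,
    fun i => LinearMap.ext fun x => ?_⟩
  · simp only [LinearMap.smul_apply, hB.symm x y]
  · simp only [LinearMap.smul_apply, smul_eq_mul]
    exact mul_pos (by positivity) (hB.pos x hx)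
  · simp only [LinearMap.smul_apply, hB.inv g hg]
  · simp only [LinearMap.smul_apply, smul_eq_mul]
    rw [div_mul_eq_mul_div, ← hcoroot i x, hq, mul_div_assoc, div_self hpos.ne', mul_one]

/-- The real number `a + b * φ`. -/
noncomputable def goldenVal (p : ℤ × ℤ) : ℝ := p.1 + p.2 * Real.goldenRatio

theorem goldenVal_add (p q : ℤ × ℤ) : goldenVal (p + q) = goldenVal p + goldenVal q := by
  simp only [goldenVal, Prod.fst_add, Prod.snd_add, Int.cast_add]
  ring

theorem goldenVal_sub (p q : ℤ × ℤ) : goldenVal (p - q) = goldenVal p - goldenVal q := by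
  simp only [goldenVal, Prod.fst_sub, Prod.snd_sub, Int.cast_sub]
  ring

theorem goldenVal_neg (p : ℤ × ℤ) : goldenVal (-p) = -goldenVal p := by
  simp only [goldenVal, Prod.fst_neg, Prod.snd_neg, Int.cast_neg]
  ring

theorem goldenVal_shift (p : ℤ × ℤ) :
    goldenVal (goldenShift p) = Real.goldenRatio * goldenVal p := by
  simp only [goldenVal, goldenShift, Int.cast_add]
  linear_combination (-(p.2 : ℝ)) * Real.goldenRatio_sq

theorem goldenVal_mul (p q : ℤ × ℤ) : goldenVal (goldenMul p q) = goldenVal p * goldenVal q := by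
  simp only [goldenVal, goldenMul, Int.cast_add, Int.cast_mul]
  linear_combination (-(p.2 : ℝ) * q.2) * Real.goldenRatio_sq

theorem goldenVal_zero : goldenVal 0 = 0 := by simp [goldenVal]

/-- The vector with given coordinates with respect to four simple roots. -/
noncomputable def goldenEval (α : Fin 4 → U) (r : GoldenVector) : U :=
  goldenVal r.1 • α 0 + goldenVal r.2.1 • α 1 + goldenVal r.2.2.1 • α 2 + goldenVal r.2.2.2 • α 3

theorem goldenEval_neg (α : Fin 4 → U) (r : GoldenVector) :
    goldenEval α (-r) = -goldenEval α r := by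
  simp only [goldenEval, Prod.fst_neg, Prod.snd_neg, goldenVal_neg, neg_smul]
  abel

variable {α : Fin 4 → U}

/-- The Gram matrix of the simple roots is that of type `H₄`. -/
def HasGramH4 (B : LinearMap.BilinForm ℝ U) (α : Fin 4 → U) : Prop :=
  ∀ i j, B (α i) (α j) = !![2, -1, 0, 0; -1, 2, -1, 0; 0, -1, 2, -Real.goldenRatio;
      0, 0, -Real.goldenRatio, 2] i j

theorem HasGramH4.self (h : HasGramH4 B α) (i : Fin 4) : B (α i) (α i) = 2 := by
  rw [h]
  fin_cases i <;> rfl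

theorem HasGramH4.apply_goldenEval (h : HasGramH4 B α) (i : Fin 4) (r : GoldenVector) :
    B (α i) (goldenEval α r) = goldenVal (goldenCoroot i r) := by
  simp only [goldenEval, map_add, map_smul, smul_eq_mul, h i]
  fin_cases i <;>
    simp [goldenCoroot, goldenVal_add, goldenVal_sub, goldenVal_shift] <;> ring

theorem HasGramH4.goldenEval_goldenReflect (h : HasGramH4 B α) (i : Fin 4) (r : GoldenVector) :
    goldenEval α (goldenReflect i r) = rootReflection B (α i) (goldenEval α r) := by
  rw [rootReflection_apply (h.self i), h.apply_goldenEval, goldenEval, goldenEval]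
  fin_cases i <;> simp only [goldenReflect, goldenVal_sub, sub_smul, Fin.zero_eta, Fin.mk_one,
    Fin.reduceFinMk] <;> abel

theorem HasGramH4.form_goldenEval (h : HasGramH4 B α) (r s : GoldenVector) :
    B (goldenEval α r) (goldenEval α s) = goldenVal (goldenForm r s) := by
  conv_lhs => rw [goldenEval]
  simp only [map_add, map_smul, LinearMap.add_apply, LinearMap.smul_apply, smul_eq_mul,
    h.apply_goldenEval, goldenForm, goldenVal_add, goldenVal_mul]

/-- The orbit of the first simple root. -/
def simpleOrbit (G : Subgroup (U ≃ₗ[ℝ] U)) (α : Fin 4 → U) : Set U :=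
  {x | ∃ g ∈ G, g (α 0) = x}

theorem map_mem_simpleOrbit {g : U ≃ₗ[ℝ] U} (hg : g ∈ G) {x : U} (hx : x ∈ simpleOrbit G α) :
    g x ∈ simpleOrbit G α := by
  obtain ⟨k, hk, rfl⟩ := hx
  exact ⟨g * k, mul_mem hg hk, rfl⟩

theorem goldenEval_wordRoot_mem (h : HasGramH4 B α) (hα : ∀ i, rootReflection B (α i) ∈ G)
    (w : List (Fin 4)) : goldenEval α (goldenWordRoot w) ∈ simpleOrbit G α := by
  induction w with
  | nil =>
    refine ⟨1, one_mem _, ?_⟩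
    simp [goldenWordRoot, goldenSimple, goldenEval, goldenVal]
  | cons i w ih =>
    rw [goldenWordRoot, List.foldr_cons, h.goldenEval_goldenReflect]
    exact map_mem_simpleOrbit (hα i) ih

/-- The edge labels 3, 3, 5 are odd, so all simple roots are conjugate; the words, applied from
right to left, witness it. -/
theorem simple_mem_simpleOrbit (h : HasGramH4 B α) (hα : ∀ i, rootReflection B (α i) ∈ G)
    (i : Fin 4) : α i ∈ simpleOrbit G α := by
  have h1 := goldenEval_wordRoot_mem h hα
  fin_cases i
  · convert h1 []
    simp [goldenWordRoot, goldenSimple, goldenEval, goldenVal]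
  · convert h1 [0, 1]
    rw [show goldenWordRoot [0, 1] = ((0, 0), (1, 0), (0, 0), (0, 0)) by decide +kernel]
    simp [goldenEval, goldenVal]
  · convert h1 [1, 2, 0, 1]
    rw [show goldenWordRoot [1, 2, 0, 1] = ((0, 0), (0, 0), (1, 0), (0, 0)) by decide +kernel]
    simp [goldenEval, goldenVal]
  · convert h1 [2, 3, 2, 3, 1, 2, 0, 1]
    rw [show goldenWordRoot [2, 3, 2, 3, 1, 2, 0, 1] = ((0, 0), (0, 0), (0, 0), (1, 0)) by
      decide +kernel]
    simp [goldenEval, goldenVal]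

theorem simpleOrbit_subset_rootsOf (hB : IsInvariantForm G B) (h : HasGramH4 B α)
    (hα : ∀ i, rootReflection B (α i) ∈ G) : simpleOrbit G α ⊆ rootsOf G B := by
  rintro _ ⟨g, hg, rfl⟩
  exact hB.map_mem_rootsOf hg ⟨h.self 0, hα 0⟩

theorem isRootSystem_simpleOrbit [Finite G] (hB : IsInvariantForm G B) (h : HasGramH4 B α)
    (hα : ∀ i, rootReflection B (α i) ∈ G) : IsRootSystem B (simpleOrbit G α) where
  symm := hB.symm
  finite := finite_rootsOf.subset (simpleOrbit_subset_rootsOf hB h hα)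
  norm _ hx := (simpleOrbit_subset_rootsOf hB h hα hx).1
  stable _ hx _ hy := map_mem_simpleOrbit (simpleOrbit_subset_rootsOf hB h hα hx).2 hy

/-- Every root in the orbit has, up to sign, coordinates in the explicit list of positive roots. -/
theorem exists_goldenRoot (h : HasGramH4 B α)
    (hG : G ≤ Subgroup.closure (rootReflection B '' Set.range α)) {x : U}
    (hx : x ∈ simpleOrbit G α) :
    ∃ r ∈ goldenRoots, x = goldenEval α r ∨ x = -goldenEval α r := by
  obtain ⟨g, hg, rfl⟩ := hx
  obtain ⟨l, hl, rfl⟩ := exists_reflectionWord (B := B) (Δ := Set.range α)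
    (by rintro _ ⟨i, rfl⟩; exact h.self i) (hG hg)
  clear hg
  induction l with
  | nil =>
    refine ⟨goldenSimple, by decide +kernel, Or.inl ?_⟩
    simp [reflectionWord, goldenSimple, goldenEval, goldenVal]
  | cons δ l ih =>
    rw [List.forall_mem_cons] at hl
    obtain ⟨⟨i, rfl⟩, hl⟩ := hl
    obtain ⟨r, hr, hrx⟩ := ih hl
    have h1 : reflectionWord B (α i :: l) (α 0) =
        rootReflection B (α i) (reflectionWord B l (α 0)) := rfl
    have h2 : reflectionWord B (α i :: l) (α 0) = goldenEval α (goldenReflect i r) ∨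
        reflectionWord B (α i :: l) (α 0) = -goldenEval α (goldenReflect i r) := by
      rw [h1, h.goldenEval_goldenReflect]
      rcases hrx with hrx | hrx
      · exact Or.inl (by rw [hrx])
      · exact Or.inr (by rw [hrx, map_neg])
    rcases goldenReflect_mem r hr i with h3 | h3
    · exact ⟨_, h3, h2⟩
    · refine ⟨_, h3, ?_⟩
      rw [goldenEval_neg, neg_neg]
      exact h2.symm

/-- In type `H₄`, any two roots have a common orthogonal root. -/
theorem exists_orthogonal_root (hB : IsInvariantForm G B) (h : HasGramH4 B α)
    (hα : ∀ i, rootReflection B (α i) ∈ G)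
    (hG : G ≤ Subgroup.closure (rootReflection B '' Set.range α)) {x y : U}
    (hx : x ∈ simpleOrbit G α) (hy : y ∈ simpleOrbit G α) :
    ∃ z ∈ simpleOrbit G α, B x z = 0 ∧ B y z = 0 := by
  obtain ⟨g, hg, rfl⟩ := hx
  -- Translating by `g⁻¹` moves `x` to the first simple root, the case covered by the table.
  obtain ⟨r, hr, hry⟩ := exists_goldenRoot h hG (map_mem_simpleOrbit (inv_mem hg) hy)
  obtain ⟨w, -, hw0, hwr⟩ := exists_goldenWord_orthogonal r hr
  refine ⟨_, map_mem_simpleOrbit hg (goldenEval_wordRoot_mem h hα w), ?_, ?_⟩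
  · rw [hB.inv g hg, h.apply_goldenEval, hw0, goldenVal_zero]
  · have hy' : y = g (g⁻¹ y) := (g.apply_symm_apply y).symm
    rw [hy', hB.inv g hg]
    rcases hry with hry | hry
    · rw [hry, h.form_goldenEval, hwr, goldenVal_zero]
    · rw [hry, map_neg, LinearMap.neg_apply, h.form_goldenEval, hwr, goldenVal_zero, neg_zero]

variable [FiniteDimensional ℝ U]

/-- The common kernel of the four simple coroots is fixed by `G` and has codimension at most four.
-/
theorem finrank_le_of_typeH4 (h : HasGramH4 B α)
    (hG : G ≤ Subgroup.closure (rootReflection B '' Set.range α)) :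
    Module.finrank ℝ U ≤ Module.finrank ℝ (fixedBy G) + 4 := by
  let Λ : U →ₗ[ℝ] (Fin 4 → ℝ) := LinearMap.pi fun i => B (α i)
  have hle : LinearMap.ker Λ ≤ fixedBy G := fun x hx => by
    refine mem_fixedBy.2 fun g hg => eq_of_mem_closure_rootReflection
      (by rintro _ ⟨i, rfl⟩; exact h.self i) ?_ (hG hg)
    rintro _ ⟨i, rfl⟩
    exact congrFun hx i
  have h1 := Λ.finrank_range_add_finrank_ker
  have h2 := Submodule.finrank_le (LinearMap.range Λ)
  have h3 := Submodule.finrank_mono hle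
  rw [Module.finrank_fin_fun] at h2
  omega

/-- The cases are codimension zero, one, two and at least three of the fixed space; the last leaves
at most one dimension above the invariants. -/
theorem generatedOnFixed_of_typeH4 (hG : IsReflectionGroup G) (hH : IsOfTypeH4 G)
    {g : U ≃ₗ[ℝ] U} (hg : g ∈ G) : GeneratedOnFixed G g := by
  have := hG.1
  obtain ⟨α, f, hgram, hcl⟩ := hH
  obtain ⟨B₀, hB₀⟩ := exists_isInvariantForm G
  have hself : ∀ i, f i (α i) = 2 := fun i => by
    rw [hgram, h4_gram]
    fin_cases i <;> rfl
  obtain ⟨B, hB, hBf⟩ := exists_form_of_typeH4 hB₀ hgram fun i =>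
    ⟨Module.reflection (hself i), hcl ▸ Subgroup.subset_closure
      ⟨i, fun x => Module.reflection_apply x (hself i)⟩,
      fun x => Module.reflection_apply x (hself i)⟩
  have hgr : HasGramH4 B α := fun i j => by rw [hBf, hgram, h4_gram]
  have hform : ∀ i x, rootReflection B (α i) x = x - f i x • α i := fun i x => by
    rw [rootReflection_apply (hgr.self i), hBf]
  have hα : ∀ i, rootReflection B (α i) ∈ G := fun i => by
    rw [← hcl]
    exact Subgroup.subset_closure ⟨i, hform i⟩
  have hle : G ≤ Subgroup.closure (rootReflection B '' Set.range α) := by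
    conv_lhs => rw [← hcl]
    refine Subgroup.closure_mono ?_
    rintro s ⟨i, hs⟩
    exact ⟨α i, ⟨i, rfl⟩, LinearEquiv.ext fun x => by rw [hform, hs]⟩
  have hrank := finrank_le_of_typeH4 hgr hle
  by_cases h1 : g = 1
  · rw [h1]
    exact generatedOnFixed_one hG
  have h2 := finrank_fixed_lt h1
  by_cases h3 : Module.finrank ℝ (g : U →ₗ[ℝ] U).fixedSubmodule + 1 = Module.finrank ℝ U
  · exact generatedOnFixed_of_isReflection hG hg (isReflection_of_finrank h3)
  by_cases h4 : Module.finrank ℝ (g : U →ₗ[ℝ] U).fixedSubmodule + 2 = Module.finrank ℝ U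
  · have hΦ := isRootSystem_simpleOrbit hB hgr hα
    have hleΦ : G ≤ Subgroup.closure (rootReflection B '' simpleOrbit G α) := by
      refine hle.trans (Subgroup.closure_mono (Set.image_mono ?_))
      rintro _ ⟨i, rfl⟩
      exact simple_mem_simpleOrbit hgr hα i
    obtain ⟨γ, hγ, hgγ⟩ := exists_fixed_root hΦ hleΦ
      (fun x hx y hy => exists_orthogonal_root hB hgr hα hle hx hy) hg h4
    exact generatedOnFixed_of_root hB hg (by omega)
      (simpleOrbit_subset_rootsOf hB hgr hα hγ) hgγ
  · exact generatedOnFixed_of_finrank_le hg (by omega)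

end TypeH4

end ReflQuot
theorem mainTheorem12 :
    (∀ (V : Type*) [AddCommGroup V] [Module ℂ V] [FiniteDimensional ℂ V]
      (G : Subgroup (V ≃ₗ[ℂ] V)),
      ReflQuot.IsReflectionGroup G → ReflQuot.rank G ≤ 2 →
        ∀ g : G, ReflQuot.SmoothFixedQuotient G g) ∧
    (∀ (U : Type*) [AddCommGroup U] [Module ℝ U] [FiniteDimensional ℝ U]
      (G : Subgroup (U ≃ₗ[ℝ] U)),
      ReflQuot.IsReflectionGroup G → (ReflQuot.rank G ≤ 3 ∨ ReflQuot.IsOfTypeH4 G) →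
        ∀ g : ReflQuot.complexify G,
          ReflQuot.SmoothFixedQuotient (ReflQuot.complexify G) g) := by
  refine ⟨fun V _ _ _ G hG hr g => ?_, fun U _ _ _ G hG hr g => ?_⟩
  · have := hG.1
    exact ReflQuot.smoothFixedQuotient_of_generatedOnFixed g
      (ReflQuot.generatedOnFixed_of_rank_le_two hG hr g.2)
  · have := hG.1
    refine ReflQuot.smoothFixedQuotient_complexify (fun g hg => ?_) g
    rcases hr with hr | hr
    · exact ReflQuot.generatedOnFixed_of_rank_le_three hG hr hg
    · exact ReflQuot.generatedOnFixed_of_typeH4 hG hr hg
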